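/- Conventions. Let $n,d\ge 0$ and $r_1,\dots,r_n\ge 0$ be integers with $3d-1=n+\sum_i r_i$. An abstract ($n$-marked, rational) tropical curve $(\Gamma,x_1,\dots,x_n)$ is a finite metric tree $\Gamma$ with all vertices of valence at least $3$, whose bounded edges have positive length, and with unbounded ends, of which $n$ are marked by the labels $x_1,\dots,x_n$; the other ends carry no labels. A tropical curve $C=(\Gamma,x_i,h)$ of degree $d$ in $\mathbb R^2$ consists of such a $(\Gamma,x_i)$ and a continuous map $h:\Gamma\to\mathbb R^2$ that is affine with integral derivative on each edge, contracts each marked end to a point, satisfies the balancing condition at each vertex, and maps the unmarked ends with the (outward) derivatives $(-1,0)$, $(0,-1)$, $(1,1)$, each occurring exactly $d$ times. Two such curves are identified if there is an isometry of the trees that respects the marked ends and commutes with the maps to $\mathbb R^2$. The weight of an edge is the integral length (the gcd of the coordinates) of the derivative of $h$ along it. We write $\mathrm{ev}(C)=(h(x_1),\dots,h(x_n))$. Let $X$ be the set of all tropical curves of degree $d$ (the support of $\prod_k\psi_k^{r_k}\cdot\mathcal M_{0,n}(\mathbb R^2,d)$) such that each vertex $V$ has valence at least $3+\sum_{x_i\text{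 adjacent to }V}r_i$. The curves for which equality holds at each vertex form the interiors of the facets of $X$. Points $P=(P_1,\dots,P_n)\in(\mathbb R^2)^n$ are general if every $C\in X$ with $\mathrm{ev}(C)=P$ lies in the interior of a facet of $X$ and is the only curve of its combinatorial type (same tree with its ends and same derivatives on the edges, arbitrary positive lengths, arbitrary position) with $\mathrm{ev}=P$, i.e. the fibre of $\mathrm{ev}$ over $P$ has the expected dimension $0$. A curve $C$ is simple if (all edges $e,e'$ below are bounded edges or unmarked ends; $e$ and $e'$ are mapped on top of each other if $h(e)\cap h(e')$ is infinite; $e$ passes through $p$ if $p$ lies in the image of the relative interior of $e$): 1. $h$ is injective on vertices; 2. if $h(V)\in h(e)$ for a vertex $V$ and an edge $e$, then $V$ is adjacent to an edge $e'$ that is mapped on top of $e$; 3. if two different edges are mapped on top of each other, then they share a vertex; 4. if more than two edges pass through a point $p\in\mathbb R^2$, then at most two different slopes occur among the lines to which these edges are mapped. The points $P$ are restricted general if they are general and every $C\in X$ with $\mathrm{ev}(C)=P$ is simple. The labelled image of $C$ is the set $h(\Gamma)\subset\mathbb R^2$ together with the labelling of each image edge by the partition (multiset) formed by the weights of all edges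 of $\Gamma$ that are mapped onto it; that is, $h(\Gamma)$ together with the function which assigns to all but finitely many points $p$ of the plane the multiset of the weights of the bounded edges and unmarked ends $e$ with $p\in h(e)$. Statement. Let $P_1,\dots,P_n$ be restricted general, and let $L$ be the labelled image of a curve in $X$ with $\mathrm{ev}=(P_1,\dots,P_n)$. Then there is, up to isomorphism, exactly one curve $C=(\Gamma,x_i,h)\in X$, i.e. exactly one abstract tropical curve $(\Gamma,x_i)$ together with one map $h$, whose labelled image is $L$ and which sends the marked end $x_i$ to $P_i$ for all $i$. -/

import Mathlib

namespace TropicalDescendant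

/-- The real vector attached to an integral vector of the plane. -/
def toPlane (u : ℤ × ℤ) : ℝ × ℝ := ((u.1 : ℝ), (u.2 : ℝ))

/-- An abstract rational tropical curve `(Γ, x₁, …, xₙ)`: a finite metric tree with unbounded ends,
of which `n` are marked and labelled, and the others are not labelled; every vertex has valence at
least three.  It is recorded by its vertices, its bounded edges (the edges of a tree) with their
lengths, its unmarked ends and its marked ends, each end with the vertex it is attached to.
Only the values of `len` on the edges of the tree matter. -/
structure AbstractCurve (n : ℕ) where
  V : Type
  fintypeV : Fintype V
  graph : SimpleGraph V
  isTree : graph.IsTree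
  len : Sym2 V → ℝ
  len_pos : ∀ v w, graph.Adj v w → 0 < len s(v, w)
  End : Type
  fintypeEnd : Fintype End
  endAt : End → V
  markAt : Fin n → V
  stable : ∀ v, 3 ≤ {w | graph.Adj v w}.ncard + {b | endAt b = v}.ncard + {i | markAt i = v}.ncard

attribute [instance] AbstractCurve.fintypeV AbstractCurve.fintypeEnd

namespace AbstractCurve

variable {n : ℕ} (Γ : AbstractCurve n)

/-- The valence of a vertex: bounded edges, unmarked ends and marked ends are all counted. -/
noncomputable def valence (v : Γ.V) : ℕ :=
  {w | Γ.graph.Adj v w}.ncard + {b | Γ.endAt b = v}.ncard + {i | Γ.markAt i = v}.ncard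

/-- The edges of `Γ` other than the marked ends: bounded edges and unmarked ends. -/
abbrev Edge : Type := Γ.graph.edgeSet ⊕ Γ.End

/-- The vertex `v` is adjacent to the edge `e`. -/
def Incident (v : Γ.V) : Γ.Edge → Prop
  | Sum.inl e => v ∈ e.1
  | Sum.inr b => Γ.endAt b = v

/-- Isomorphisms of abstract tropical curves: isometries of the metric trees that respect the
labels of the marked ends. -/
structure Iso (Γ Γ' : AbstractCurve n) where
  onV : Γ.graph ≃g Γ'.graph
  onEnd : Γ.End ≃ Γ'.End
  len_eq : ∀ v w, Γ.graph.Adj v w → Γ'.len s(onV v, onV w) = Γ.len s(v, w)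
  endAt_eq : ∀ b, Γ'.endAt (onEnd b) = onV (Γ.endAt b)
  markAt_eq : ∀ i, Γ'.markAt i = onV (Γ.markAt i)

open Classical in
/-- The sum of the exponents `r i` over the marked ends `x i` adjacent to the vertex `v`. -/
noncomputable def psiSum (r : Fin n → ℕ) (v : Γ.V) : ℕ :=
  ∑ i with Γ.markAt i = v, r i

/-- `Γ` lies in (the support of) the intersection product `∏ ψᵢ ^ rᵢ`. This support is the union of
the closed cells whose vertices all have valence exactly `3 + ∑ rᵢ`, the sum being taken over the
marked ends at the vertex; a curve lies in it if and only if all valences are at least that big. -/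
def SatisfiesPsi (r : Fin n → ℕ) : Prop :=
  ∀ v, 3 + Γ.psiSum r v ≤ Γ.valence v

/-- `Γ` lies in the interior of a facet of (the support of) `∏ ψᵢ ^ rᵢ`. -/
def InteriorOfFacet (r : Fin n → ℕ) : Prop :=
  ∀ v, Γ.valence v = 3 + Γ.psiSum r v

end AbstractCurve

/-- A parametrized rational tropical curve `C = (Γ, xᵢ, h)` of degree `d` in the plane. The map
`h : Γ → ℝ²` is affine with integral derivative on each edge and contracts the marked ends, so it
is recorded by the images `pos v` of the vertices, by the derivative `dir v w` along a bounded edge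
from `v` to `w`, and by the derivative `endDir b` along an unmarked end `b` (pointing outwards).
The balancing condition holds at each vertex, and the unmarked ends have the directions
`(-1, 0)`, `(0, -1)`, `(1, 1)`, each occurring `d` times.
Only the values of `dir` on pairs of adjacent vertices matter. -/
structure TropicalCurve (n d : ℕ) extends AbstractCurve n where
  pos : V → ℝ × ℝ
  dir : V → V → ℤ × ℤ
  dir_symm : ∀ v w, dir w v = -dir v w
  endDir : End → ℤ × ℤ
  pos_eq : ∀ v w, graph.Adj v w → pos w = pos v + len s(v, w) • toPlane (dir v w)
  balanced : ∀ v, (∑ᶠ w ∈ {w | graph.Adj v w}, dir v w) + (∑ᶠ b ∈ {b | endAt b = v}, endDir b) = 0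
  endDir_mem : ∀ b, endDir b = (-1, 0) ∨ endDir b = (0, -1) ∨ endDir b = (1, 1)
  degree₁ : {b | endDir b = (-1, 0)}.ncard = d
  degree₂ : {b | endDir b = (0, -1)}.ncard = d
  degree₀ : {b | endDir b = (1, 1)}.ncard = d

namespace TropicalCurve

variable {n d : ℕ} (C : TropicalCurve n d)

/-- The images of the marked ends. -/
def ev (i : Fin n) : ℝ × ℝ := C.pos (C.markAt i)

/-- The image `h(e)` of a (closed) edge. -/
def edgeImage : C.Edge → Set (ℝ × ℝ)
  | Sum.inl e => {p | ∃ v w, s(v, w) = e.1 ∧ ∃ t : ℝ, 0 ≤ t ∧ t ≤ C.len e.1 ∧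
      p = C.pos v + t • toPlane (C.dir v w)}
  | Sum.inr b => {p | ∃ t : ℝ, 0 ≤ t ∧ p = C.pos (C.endAt b) + t • toPlane (C.endDir b)}

/-- The image of an open edge, i.e. of the edge without its adjacent vertices. -/
def openEdgeImage : C.Edge → Set (ℝ × ℝ)
  | Sum.inl e => {p | ∃ v w, s(v, w) = e.1 ∧ ∃ t : ℝ, 0 < t ∧ t < C.len e.1 ∧
      p = C.pos v + t • toPlane (C.dir v w)}
  | Sum.inr b => {p | ∃ t : ℝ, 0 < t ∧ p = C.pos (C.endAt b) + t • toPlane (C.endDir b)}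

/-- The image `h(Γ)`. -/
def image : Set (ℝ × ℝ) := Set.range C.pos ∪ ⋃ e, C.edgeImage e

/-- The weight of an edge: the integral length of the derivative of `h` along it. -/
def weight : C.Edge → ℕ
  | Sum.inl e => Sym2.lift ⟨fun v w => Int.gcd (C.dir v w).1 (C.dir v w).2, fun v w => by
      simp [C.dir_symm w v]⟩ e.1
  | Sum.inr b => Int.gcd (C.endDir b).1 (C.endDir b).2

open Classical in
/-- The multiset of the weights of all edges whose images contain `p`. -/
noncomputable def weightsAt (p : ℝ × ℝ) : Multiset ℕ :=
  ((Finset.univ : Finset C.Edge).filter fun e => p ∈ C.edgeImage e).val.map C.weight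

/-- The edges `e` and `e'` are mapped on top of each other: their images overlap in more than
finitely many points. -/
def OnTop (e e' : C.Edge) : Prop := (C.edgeImage e ∩ C.edgeImage e').Infinite

/-- Simple curves. An edge passes through `p` if `p` lies in the image of the open edge; the slope
of the line to which an edge is mapped is the space of vectors parallel to this line. -/
structure IsSimple : Prop where
  injective_vertices : Function.Injective C.pos
  vertex_on_edge : ∀ (v : C.V) (e : C.Edge), C.pos v ∈ C.edgeImage e →
    ∃ e', C.Incident v e' ∧ C.OnTop e' e
  overlap_shares_vertex : ∀ e e' : C.Edge, e ≠ e' → C.OnTop e e' →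
    ∃ v, C.Incident v e ∧ C.Incident v e'
  slopes : ∀ p : ℝ × ℝ, 2 < {e | p ∈ C.openEdgeImage e}.ncard →
    ((fun e => vectorSpan ℝ (C.edgeImage e)) '' {e | p ∈ C.openEdgeImage e}).ncard ≤ 2

/-- `C` is isolated in the fibre of the evaluation map: it is the only curve of its combinatorial
type (same tree, same ends, same directions, arbitrary positive lengths and arbitrary vertex
positions) that sends the marked ends to the points `C.ev i`. As a cell of the moduli space is
convex and the evaluation map is affine on it, this says that the fibre has dimension zero
in the cell of `C`, or that the evaluation map is injective on this cell. -/
def IsRigid : Prop :=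
  ∀ (len' : Sym2 C.V → ℝ) (pos' : C.V → ℝ × ℝ),
    (∀ v w, C.graph.Adj v w → 0 < len' s(v, w)) →
    (∀ v w, C.graph.Adj v w → pos' w = pos' v + len' s(v, w) • toPlane (C.dir v w)) →
    (∀ i, pos' (C.markAt i) = C.ev i) →
    pos' = C.pos ∧ ∀ v w, C.graph.Adj v w → len' s(v, w) = C.len s(v, w)

/-- Two parametrized curves are the same point of the moduli space (where the unmarked ends carry no
labels): there is an isomorphism of the abstract curves that is compatible with the maps to the
plane. -/
def SameCurve (C C' : TropicalCurve n d) : Prop :=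
  ∃ f : AbstractCurve.Iso C.toAbstractCurve C'.toAbstractCurve,
    (∀ v, C'.pos (f.onV v) = C.pos v) ∧
    (∀ v w, C.graph.Adj v w → C'.dir (f.onV v) (f.onV w) = C.dir v w) ∧
    (∀ b, C'.endDir (f.onEnd b) = C.endDir b)

end TropicalCurve

/-- A set in the plane, together with a multiset (partition) at all but finitely many points. -/
@[ext] structure LabelledImage where
  carrier : Set (ℝ × ℝ)
  label : Filter.Germ (Filter.cofinite : Filter (ℝ × ℝ)) (Multiset ℕ)

/-- The labelled image of `C`: the image `h(Γ)`, each image edge being marked with the partition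
formed by the weights of all the edges that are mapped onto it. The partition is constant along an
image edge, so the marking amounts to the weights over all but finitely many points. -/
noncomputable def TropicalCurve.labelledImage {n d : ℕ} (C : TropicalCurve n d) : LabelledImage where
  carrier := C.image
  label := ((C.weightsAt : ℝ × ℝ → Multiset ℕ) :
    Filter.Germ (Filter.cofinite : Filter (ℝ × ℝ)) (Multiset ℕ))

/-- `C` satisfies the Psi-conditions `ψᵢ ^ rᵢ` and passes through the points `P i`. -/
def PassesThrough {n d : ℕ} (r : Fin n → ℕ) (P : Fin n → ℝ × ℝ) (C : TropicalCurve n d) : Prop :=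
  C.SatisfiesPsi r ∧ ∀ i, C.ev i = P i

/-- General point conditions: the fibre of the evaluation map over `P` in `∏ ψᵢ ^ rᵢ` meets only
the interiors of facets and has dimension zero. -/
def IsGeneral {n : ℕ} (d : ℕ) (r : Fin n → ℕ) (P : Fin n → ℝ × ℝ) : Prop :=
  ∀ C : TropicalCurve n d, PassesThrough r P C → C.InteriorOfFacet r ∧ C.IsRigid

/-- Restricted general point conditions: general conditions through which only simple curves of
`∏ ψᵢ ^ rᵢ` pass. -/
def IsRestrictedGeneral {n : ℕ} (d : ℕ) (r : Fin n → ℕ) (P : Fin n → ℝ × ℝ) : Prop :=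
  IsGeneral d r P ∧ ∀ C : TropicalCurve n d, PassesThrough r P C → C.IsSimple

/-- `C` parametrizes the labelled image `L`, it satisfies the Psi-conditions, and it sends the
marked ends to the points `P i`. -/
def Parametrizes {n d : ℕ} (r : Fin n → ℕ) (P : Fin n → ℝ × ℝ) (L : LabelledImage)
    (C : TropicalCurve n d) : Prop :=
  PassesThrough r P C ∧ C.labelledImage = L

end TropicalDescendant

/-! ### Nets of segments and rays, and the germs of their edges -/

namespace TropicalDescendant

/-! Only uniqueness needs an argument. Two parametrizations of `L` through the points are both
simple, rigid and interior to a facet. The difficulty is overlap: where several edges lie on one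
line, the weights alone do not say which edge stops at a vertex and which runs over it.

Vertices. A marked vertex lies at its given point. An unmarked one is trivalent, and by balancing
and rigidity its three directions are pairwise independent; in a simple curve, edges of three slopes
meet only at a vertex. So the two curves have the same vertex positions (`range_pos_subset`), hence
the same number of edges at each, by the facet equality; the multisets of weights along every germ
agree too. This is `Net.Similar`, a relation between nets, which remember only segments, rays,
weights and the forest property.

Overlaps. If an edge runs over a vertex p, simplicity and the absence of cycles force exactly one
edge at p on that line, and all edges running over p end at its other end q
(`PassLine.exists_unique_at`). Suppose a line is run over at p in one net but not in the other. Then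
p and q are joined in both nets, and at q the roles of the nets are exchanged (`Similar.switch`). As
the valences at p agree, a second line through p must differ in the opposite sense
(`Similar.exists_switched`). So every vertex where the nets differ has two distinct neighbours where
they differ, which is impossible in a finite forest (`Similar.not_switched`).

Edges. Once the nets agree about which lines run over which vertices, a shortest bounded edge
present in only one of them is excluded by comparing weights at its ends (`Similar.hasEdge_iff`).
The unbounded edges are what remains of the valence in each direction (`Similar.card_ends_eq`).
Segment and weight determine the derivative of an edge, and the isomorphism follows
(`sameCurve_of_similar`). -/

/-- The combinatorial content of the image of a simple rational curve: finitely many segments and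
rays in the plane whose end points are vertices of a forest, overlapping only if they share a
vertex. -/
structure Net where
  E : Type
  fintypeE : Fintype E
  verts : Set (ℝ × ℝ)
  finite_verts : verts.Finite
  img : E → Set (ℝ × ℝ)
  At : ℝ × ℝ → E → Prop
  wt : E → ℕ
  at_mem : ∀ {p e}, At p e → p ∈ verts
  shape : ∀ e, (∃ p q, p ≠ q ∧ (∀ x, At x e ↔ x = p ∨ x = q) ∧ img e = segment ℝ p q) ∨
    (∃ p D, D ≠ 0 ∧ (∀ x, At x e ↔ x = p) ∧ img e = {x | ∃ t : ℝ, 0 ≤ t ∧ x = p + t • D})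
  vertex_on_edge : ∀ {p e}, p ∈ verts → p ∈ img e → ∃ e', At p e' ∧ (img e' ∩ img e).Infinite
  overlap : ∀ {e e'}, e ≠ e' → (img e ∩ img e').Infinite → ∃ p, At p e ∧ At p e'
  double : ∀ {p q e e'}, p ≠ q → At p e → At q e → At p e' → At q e' → e = e'
  -- Acyclicity in the form used below: every nonempty set of vertices has a member with at most one
  -- neighbour in the set.
  leaf : ∀ T : Set (ℝ × ℝ), T ⊆ verts → T.Nonempty → ∃ p ∈ T, ∀ q ∈ T, ∀ r ∈ T, q ≠ p → r ≠ p →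
    (∃ e, At p e ∧ At q e) → (∃ e, At p e ∧ At r e) → q = r

attribute [instance] Net.fintypeE

namespace Net

variable (N : Net)

/-- The edge `e` contains the germ at `p` of the ray in direction `u`. -/
def Covers (e : N.E) (p u : ℝ × ℝ) : Prop :=
  p ∈ N.img e ∧ ∃ ε : ℝ, 0 < ε ∧ p + ε • u ∈ N.img e

open Classical in
/-- The edges that contain the germ at `p` of the ray in direction `u`. -/
noncomputable def cov (p u : ℝ × ℝ) : Finset N.E := {e | N.Covers e p u}

/-- Some edge runs in direction `u` over the vertex `p` without being adjacent to it. -/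
def PassLine (p u : ℝ × ℝ) : Prop := ∃ e, p ∈ N.img e ∧ ¬ N.At p e ∧ N.Covers e p u

/-- There is an edge of weight `a` between `p` and `q`. -/
def HasEdge (p q : ℝ × ℝ) (a : ℕ) : Prop := ∃ e, N.At p e ∧ N.At q e ∧ N.wt e = a

variable {N}

@[simp] lemma mem_cov {e : N.E} {p u : ℝ × ℝ} : e ∈ N.cov p u ↔ N.Covers e p u := by
  simp [cov]

lemma form_of_at {p : ℝ × ℝ} {e : N.E} (h : N.At p e) : ∃ D : ℝ × ℝ, D ≠ 0 ∧
    (((∀ x, x ∈ N.img e ↔ ∃ t : ℝ, 0 ≤ t ∧ t ≤ 1 ∧ x = p + t • D) ∧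
        ∀ x, N.At x e ↔ x = p ∨ x = p + D) ∨
      ((∀ x, x ∈ N.img e ↔ ∃ t : ℝ, 0 ≤ t ∧ x = p + t • D) ∧ ∀ x, N.At x e ↔ x = p)) := by
  rcases N.shape e with ⟨a, b, hab, hat, him⟩ | ⟨a, D, hD, hat, him⟩
  · rcases (hat p).1 h with rfl | rfl
    · refine ⟨b - p, sub_ne_zero.2 hab.symm, Or.inl ⟨fun x => ?_, fun x => ?_⟩⟩
      · rw [him, segment_eq_image']
        simp only [Set.mem_image, Set.mem_Icc]
        exact ⟨fun ⟨t, ⟨h1, h2⟩, h3⟩ => ⟨t, h1, h2, h3.symm⟩,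
          fun ⟨t, h1, h2, h3⟩ => ⟨t, ⟨h1, h2⟩, h3.symm⟩⟩
      · rw [hat, add_sub_cancel]
    · refine ⟨a - p, sub_ne_zero.2 hab, Or.inl ⟨fun x => ?_, fun x => ?_⟩⟩
      · rw [him, segment_symm, segment_eq_image']
        simp only [Set.mem_image, Set.mem_Icc]
        exact ⟨fun ⟨t, ⟨h1, h2⟩, h3⟩ => ⟨t, h1, h2, h3.symm⟩,
          fun ⟨t, h1, h2, h3⟩ => ⟨t, ⟨h1, h2⟩, h3.symm⟩⟩
      · rw [hat, add_sub_cancel, or_comm]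
  · obtain rfl := (hat p).1 h
    exact ⟨D, hD, Or.inr ⟨fun x => by rw [him]; rfl, hat⟩⟩

lemma exists_at (e : N.E) : ∃ p, N.At p e := by
  rcases N.shape e with ⟨a, b, hab, hat, him⟩ | ⟨a, D, hD, hat, him⟩
  · exact ⟨a, (hat a).2 (Or.inl rfl)⟩
  · exact ⟨a, (hat a).2 rfl⟩

lemma At.mem_img {p : ℝ × ℝ} {e : N.E} (h : N.At p e) : p ∈ N.img e := by
  obtain ⟨D, hD, ⟨h1, h2⟩ | ⟨h1, h2⟩⟩ := form_of_at h
  · exact (h1 p).2 ⟨0, le_rfl, zero_le_one, by simp⟩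
  · exact (h1 p).2 ⟨0, le_rfl, by simp⟩

lemma At.eq_or_eq {p q r : ℝ × ℝ} {e : N.E} (hpq : p ≠ q) (hp : N.At p e) (hq : N.At q e)
    (hr : N.At r e) : r = p ∨ r = q := by
  obtain ⟨D, hD, ⟨h1, h2⟩ | ⟨h1, h2⟩⟩ := form_of_at hp
  · rcases (h2 q).1 hq with h | h
    · exact absurd h.symm hpq
    · rw [h]; exact (h2 r).1 hr
  · exact absurd ((h2 q).1 hq).symm hpq

lemma convex_img (e : N.E) : Convex ℝ (N.img e) := by
  rcases N.shape e with ⟨a, b, hab, hat, him⟩ | ⟨a, D, hD, hat, him⟩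
  · rw [him]; exact convex_segment _ _
  · rw [him]
    rintro _ ⟨s, hs, rfl⟩ _ ⟨t, ht, rfl⟩ x y hx hy hxy
    refine ⟨x * s + y * t, by positivity, ?_⟩
    have : a = x • a + y • a := by rw [← add_smul, hxy, one_smul]
    conv_rhs => rw [this]
    module

lemma isClosed_img (e : N.E) : IsClosed (N.img e) := by
  rcases N.shape e with ⟨a, b, hab, hat, him⟩ | ⟨a, D, hD, hat, him⟩
  · rw [him, segment_eq_image']
    exact (isCompact_Icc.image (by fun_prop)).isClosed
  · rw [him]
    have : {x : ℝ × ℝ | ∃ t : ℝ, 0 ≤ t ∧ x = a + t • D} =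
        (fun t : ℝ => a + t • D) '' Set.Ici 0 := by
      ext x; simp [eq_comm]
    rw [this]
    have hcl : Topology.IsClosedEmbedding fun t : ℝ => t • D :=
      isClosedEmbedding_smul_left hD
    exact ((Homeomorph.addLeft a).isClosedEmbedding.comp hcl).isClosedMap _ isClosed_Ici

lemma mem_img_of_mem {e : N.E} {p u : ℝ × ℝ} {s t : ℝ} (hp : p ∈ N.img e)
    (h : p + s • u ∈ N.img e) (ht : 0 ≤ t) (hts : t ≤ s) : p + t • u ∈ N.img e := by
  rcases hts.eq_or_lt with rfl | hlt
  · exact h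
  · have hs : 0 < s := ht.trans_lt hlt
    have := (N.convex_img e).add_smul_mem hp h (t := t / s)
      ⟨by positivity, (div_le_one hs).2 hts⟩
    rwa [smul_smul, div_mul_cancel₀ _ hs.ne'] at this

lemma Covers.smul {e : N.E} {p u : ℝ × ℝ} (h : N.Covers e p u) {c : ℝ} (hc : 0 < c) :
    N.Covers e p (c • u) := by
  obtain ⟨h1, ε, hε, h2⟩ := h
  refine ⟨h1, ε / c, by positivity, ?_⟩
  rwa [smul_smul, div_mul_cancel₀ _ hc.ne']

lemma covers_smul_iff {e : N.E} {p u : ℝ × ℝ} {c : ℝ} (hc : 0 < c) :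
    N.Covers e p (c • u) ↔ N.Covers e p u := by
  refine ⟨fun h => ?_, fun h => h.smul hc⟩
  have := h.smul (inv_pos.2 hc)
  rwa [smul_smul, inv_mul_cancel₀ hc.ne', one_smul] at this

lemma cov_smul {p u : ℝ × ℝ} {c : ℝ} (hc : 0 < c) : N.cov p (c • u) = N.cov p u := by
  ext e; simp [covers_smul_iff hc]

/-- The edge lies on a line. -/
lemma exists_line (e : N.E) : ∃ D : ℝ × ℝ, D ≠ 0 ∧
    ∀ x ∈ N.img e, ∀ y ∈ N.img e, ∃ c : ℝ, y - x = c • D := by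
  obtain ⟨p, hp⟩ := exists_at e
  obtain ⟨D, hD, ⟨h1, h2⟩ | ⟨h1, h2⟩⟩ := form_of_at hp
  · refine ⟨D, hD, fun x hx y hy => ?_⟩
    obtain ⟨s, -, -, rfl⟩ := (h1 x).1 hx
    obtain ⟨t, -, -, rfl⟩ := (h1 y).1 hy
    exact ⟨t - s, by module⟩
  · refine ⟨D, hD, fun x hx y hy => ?_⟩
    obtain ⟨s, -, rfl⟩ := (h1 x).1 hx
    obtain ⟨t, -, rfl⟩ := (h1 y).1 hy
    exact ⟨t - s, by module⟩

lemma Covers.parallel {e : N.E} {p p' u u' : ℝ × ℝ} (hu : u ≠ 0) (hu' : u' ≠ 0)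
    (h : N.Covers e p u) (h' : N.Covers e p' u') : ∃ c : ℝ, c ≠ 0 ∧ u' = c • u := by
  obtain ⟨D, hD, hl⟩ := N.exists_line e
  obtain ⟨h1, ε, hε, h2⟩ := h
  obtain ⟨h1', ε', hε', h2'⟩ := h'
  obtain ⟨c, hc⟩ := hl _ h1 _ h2
  obtain ⟨c', hc'⟩ := hl _ h1' _ h2'
  rw [add_sub_cancel_left] at hc hc'
  have hc0 : c ≠ 0 := by
    rintro rfl
    rw [zero_smul, smul_eq_zero] at hc
    exact hc.elim hε.ne' hu
  have hc0' : c' ≠ 0 := by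
    rintro rfl
    rw [zero_smul, smul_eq_zero] at hc'
    exact hc'.elim hε'.ne' hu'
  refine ⟨ε'⁻¹ * c' * c⁻¹ * ε, by positivity, ?_⟩
  rw [mul_smul, hc, smul_smul, mul_assoc, mul_assoc, inv_mul_cancel₀ hc0, mul_one, mul_smul, ← hc',
    smul_smul, inv_mul_cancel₀ hε'.ne', one_smul]

lemma exists_dir_of_at {p : ℝ × ℝ} {e : N.E} (h : N.At p e) : ∃ D : ℝ × ℝ, D ≠ 0 ∧
    ∀ u, u ≠ 0 → (N.Covers e p u ↔ ∃ c : ℝ, 0 < c ∧ u = c • D) := by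
  obtain ⟨D, hD, hf⟩ := form_of_at h
  refine ⟨D, hD, fun u hu => ?_⟩
  have key : ∀ x ∈ N.img e, ∃ t : ℝ, 0 ≤ t ∧ x = p + t • D := by
    intro x hx
    rcases hf with ⟨h1, -⟩ | ⟨h1, -⟩
    · obtain ⟨t, h0, -, h⟩ := (h1 x).1 hx
      exact ⟨t, h0, h⟩
    · exact (h1 x).1 hx
  have hcD : N.Covers e p D := by
    refine ⟨h.mem_img, 1, one_pos, ?_⟩
    rcases hf with ⟨h1, -⟩ | ⟨h1, -⟩
    · exact (h1 _).2 ⟨1, zero_le_one, le_rfl, rfl⟩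
    · exact (h1 _).2 ⟨1, zero_le_one, rfl⟩
  constructor
  · rintro ⟨-, ε, hε, h2⟩
    obtain ⟨t, ht, h3⟩ := key _ h2
    have h4 : ε • u = t • D := add_left_cancel h3
    have ht0 : t ≠ 0 := by
      rintro rfl
      rw [zero_smul, smul_eq_zero] at h4
      exact h4.elim hε.ne' hu
    refine ⟨ε⁻¹ * t, by positivity, ?_⟩
    rw [mul_smul, ← h4, smul_smul, inv_mul_cancel₀ hε.ne', one_smul]
  · rintro ⟨c, hc, rfl⟩
    exact hcD.smul hc

lemma Covers.pos_parallel {p u v : ℝ × ℝ} {e : N.E} (h : N.At p e) (hu : u ≠ 0) (hv : v ≠ 0)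
    (h1 : N.Covers e p u) (h2 : N.Covers e p v) : ∃ c : ℝ, 0 < c ∧ v = c • u := by
  obtain ⟨D, hD, hf⟩ := exists_dir_of_at h
  obtain ⟨a, ha, rfl⟩ := (hf u hu).1 h1
  obtain ⟨b, hb, rfl⟩ := (hf v hv).1 h2
  exact ⟨b * a⁻¹, by positivity, by rw [smul_smul, mul_assoc, inv_mul_cancel₀ ha.ne', mul_one]⟩

lemma not_covers_neg {p u : ℝ × ℝ} {e : N.E} (h : N.At p e) (hu : u ≠ 0)
    (h1 : N.Covers e p u) : ¬ N.Covers e p (-u) := by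
  intro h2
  obtain ⟨c, hc, h3⟩ := h1.pos_parallel h hu (neg_ne_zero.2 hu) h2
  have : (c + 1) • u = 0 := by rw [add_smul, one_smul, ← h3]; simp
  rw [smul_eq_zero] at this
  exact this.elim (by positivity) hu

/-- An edge that contains p without ending there is a segment or ray with p in its relative
interior, so it continues on both sides. -/
lemma Covers.neg {e : N.E} {p u : ℝ × ℝ} (hp : ¬ N.At p e) (h : N.Covers e p u) :
    N.Covers e p (-u) := by
  obtain ⟨h1, ε, hε, h2⟩ := h
  obtain ⟨a, ha⟩ := exists_at e
  rcases eq_or_ne u 0 with rfl | hu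
  · exact ⟨h1, 1, one_pos, by simpa using h1⟩
  have main : ∀ (D : ℝ × ℝ) (t t' : ℝ), p = a + t • D → p + ε • u = a + t' • D →
      u = ((t' - t) / ε) • D := by
    intro D t t' h3 h4
    have h5 : ε • u = (t' - t) • D := by
      rw [h3, add_assoc] at h4
      have := add_left_cancel h4
      rw [sub_smul, ← this]; abel
    rw [div_eq_inv_mul, mul_smul, ← h5, smul_smul, inv_mul_cancel₀ hε.ne', one_smul]
  -- With e parametrized from its end a and p at parameter t, any parameter s on the side of t
  -- opposite to u gives the germ: 0 if u points away from a, otherwise 1 on a segment and t + 1 on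
  -- a ray.
  have hcase : ∀ (D : ℝ × ℝ) (t c s : ℝ), p = a + t • D → u = c • D → c ≠ 0 → 0 < (s - t) / (-c) →
      a + s • D ∈ N.img e → N.Covers e p (-u) := by
    intro D t c s h3 h4 hc hpos hmem
    refine ⟨h1, (s - t) / (-c), hpos, ?_⟩
    have : p + ((s - t) / (-c)) • -u = a + s • D := by
      rw [h3, h4, ← neg_smul, smul_smul, div_mul_cancel₀ _ (neg_ne_zero.2 hc)]
      module
    rwa [this]
  obtain ⟨D, hD, hf⟩ := form_of_at ha
  have hex : ∃ t : ℝ, 0 ≤ t ∧ p = a + t • D := by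
    rcases hf with ⟨hf, -⟩ | ⟨hf, -⟩
    · obtain ⟨t, h0, -, h⟩ := (hf p).1 h1
      exact ⟨t, h0, h⟩
    · exact (hf p).1 h1
  have hex' : ∃ t : ℝ, p + ε • u = a + t • D := by
    rcases hf with ⟨hf, -⟩ | ⟨hf, -⟩
    · obtain ⟨t, h0, -, h⟩ := (hf _).1 h2
      exact ⟨t, h⟩
    · obtain ⟨t, h0, h⟩ := (hf _).1 h2
      exact ⟨t, h⟩
  obtain ⟨t, ht, h3⟩ := hex
  obtain ⟨t', h4⟩ := hex'
  have hu' := main D t t' h3 h4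
  set c := (t' - t) / ε
  have hc : c ≠ 0 := by
    rintro h; rw [h, zero_smul] at hu'; exact hu hu'
  have ht0 : 0 < t := by
    rcases ht.eq_or_lt with rfl | h
    · rw [zero_smul, add_zero] at h3
      exact absurd (h3 ▸ ha) hp
    · exact h
  rcases lt_or_gt_of_ne hc with hneg | hpos
  · rcases hf with ⟨hf, hat⟩ | ⟨hf, -⟩
    · obtain ⟨t1, ht1, ht1', h⟩ := (hf p).1 h1
      have : t1 = t := by
        have : t1 • D = t • D := add_left_cancel (h.symm.trans h3)
        exact smul_left_injective ℝ hD this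
      subst this
      have hlt : t1 < 1 := by
        refine lt_of_le_of_ne ht1' fun h1 => hp ((hat p).2 (Or.inr ?_))
        rw [h3, h1, one_smul]
      refine hcase D t1 c 1 h3 hu' hc (div_pos (by linarith) (by linarith)) ?_
      exact (hf _).2 ⟨1, zero_le_one, le_rfl, rfl⟩
    · refine hcase D t c (t + 1) h3 hu' hc (div_pos (by linarith) (by linarith)) ?_
      exact (hf _).2 ⟨t + 1, by linarith, rfl⟩
  · refine hcase D t c 0 h3 hu' hc (div_pos_of_neg_of_neg (by linarith) (by linarith)) ?_
    rw [zero_smul, add_zero]; exact ha.mem_img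

lemma covers_sub {e : N.E} {p q : ℝ × ℝ} (hp : p ∈ N.img e) (hq : q ∈ N.img e) :
    N.Covers e p (q - p) := ⟨hp, 1, one_pos, by simpa using hq⟩

lemma covers_between {e : N.E} {p u : ℝ × ℝ} {s t : ℝ} (hp : p ∈ N.img e)
    (h : p + s • u ∈ N.img e) (ht : 0 < t) (hts : t < s) :
    N.Covers e (p + t • u) u ∧ N.Covers e (p + t • u) (-u) := by
  have h1 := mem_img_of_mem hp h ht.le hts.le
  refine ⟨⟨h1, s - t, sub_pos.2 hts, ?_⟩, ⟨h1, t, ht, ?_⟩⟩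
  · rw [add_assoc, ← add_smul, add_sub_cancel]; exact h
  · simpa using hp

lemma infinite_of_covers {e e' : N.E} {p u : ℝ × ℝ} (hu : u ≠ 0) (h : N.Covers e p u)
    (h' : N.Covers e' p u) : (N.img e ∩ N.img e').Infinite := by
  obtain ⟨h1, ε, hε, h2⟩ := h
  obtain ⟨h1', ε', hε', h2'⟩ := h'
  have hinf : (Set.Icc 0 (min ε ε')).Infinite := Set.Icc_infinite (lt_min hε hε')
  refine (hinf.image (f := fun t : ℝ => p + t • u) ?_).mono ?_
  · intro s _ t _ hst
    exact smul_left_injective ℝ hu (add_left_cancel hst)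
  · rintro _ ⟨t, ⟨ht, ht'⟩, rfl⟩
    exact ⟨mem_img_of_mem h1 h2 ht (ht'.trans (min_le_left _ _)),
      mem_img_of_mem h1' h2' ht (ht'.trans (min_le_right _ _))⟩

/-- A common germ already is an infinite overlap, so simplicity applies. -/
lemma exists_common {e e' : N.E} {p u : ℝ × ℝ} (hu : u ≠ 0) (hne : e ≠ e') (h : N.Covers e p u)
    (h' : N.Covers e' p u) : ∃ q, N.At q e ∧ N.At q e' :=
  N.overlap hne (infinite_of_covers hu h h')

/-- Along a segment without vertices in its interior, the edges on it stay the same. -/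
lemma Covers.transport {e : N.E} {p u : ℝ × ℝ} {s : ℝ} (hs : 0 < s)
    (hno : ∀ t, 0 < t → t < s → p + t • u ∉ N.verts) (h : N.Covers e p u) :
    N.Covers e (p + s • u) (-u) := by
  have hq : p + s • u ∈ N.img e := by
    by_contra hq
    obtain ⟨h1, ε, hε, h2⟩ := h
    have hεs : ε < s := by
      by_contra! hle
      exact hq (mem_img_of_mem h1 h2 hs.le hle)
    have hno' : ∀ t, 0 < t → t < s → ¬ N.At (p + t • u) e := fun t h0 h1 h =>
      hno t h0 h1 (N.at_mem h)
    have hseg : ∀ t, p + t • u ∈ N.img e → t < s := by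
      intro t ht
      by_contra! hle
      exact hq (mem_img_of_mem h1 ht hs.le hle)
    -- the largest parameter on the edge is that of an end point
    let A : Set ℝ := {t | 0 < t ∧ p + t • u ∈ N.img e}
    have hA : ε ∈ A := ⟨hε, h2⟩
    have hbdd : BddAbove A := ⟨s, fun t ht => (hseg t ht.2).le⟩
    have hclosed := N.isClosed_img e
    have hcl' : IsClosed {t : ℝ | p + t • u ∈ N.img e} := hclosed.preimage (by fun_prop)
    set m := sSup A
    have hm : p + m • u ∈ N.img e := by
      have := csSup_mem_closure ⟨ε, hA⟩ hbdd
      have h3 : closure A ⊆ {t : ℝ | p + t • u ∈ N.img e} :=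
        closure_minimal (fun t ht => ht.2) hcl'
      exact h3 this
    have hm0 : 0 < m := hε.trans_le (le_csSup hbdd hA)
    have hms := hseg m hm
    have hcov : N.Covers e (p + m • u) (-u) := ⟨hm, m, hm0, by simpa using h1⟩
    obtain ⟨-, δ, hδ, h4⟩ := hcov.neg (hno' m hm0 hms)
    rw [neg_neg, add_assoc, ← add_smul] at h4
    have := le_csSup hbdd (show m + δ ∈ A from ⟨by positivity, h4⟩)
    linarith
  exact ⟨hq, s, hs, by simpa using h.1⟩

lemma cov_transport {p u : ℝ × ℝ} {s : ℝ} (hs : 0 < s)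
    (hno : ∀ t, 0 < t → t < s → p + t • u ∉ N.verts) :
    N.cov (p + s • u) (-u) = N.cov p u := by
  ext e
  rw [mem_cov, mem_cov]
  refine ⟨fun h => ?_, fun h => h.transport hs hno⟩
  have := h.transport hs (fun t ht hts => ?_)
  · simpa using this
  · have := hno (s - t) (by linarith) (by linarith)
    rwa [show p + (s - t) • u = p + s • u + t • -u by module] at this

/-- Each corner would have the other two as distinct neighbours, against `leaf` for the set of
corners. -/
lemma no_triangle {p q r : ℝ × ℝ} {e₁ e₂ e₃ : N.E} (hpq : p ≠ q) (hqr : q ≠ r) (hpr : p ≠ r)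
    (h1 : N.At p e₁) (h1' : N.At q e₁) (h2 : N.At q e₂) (h2' : N.At r e₂) (h3 : N.At p e₃)
    (h3' : N.At r e₃) : False := by
  obtain ⟨x, hx, hxx⟩ := N.leaf {p, q, r} (by
    rintro x (rfl | rfl | rfl)
    exacts [N.at_mem h1, N.at_mem h1', N.at_mem h2']) ⟨p, by simp⟩
  rcases hx with rfl | rfl | rfl
  · exact hqr (hxx q (by simp) r (by simp) hpq.symm hpr.symm ⟨_, h1, h1'⟩ ⟨_, h3, h3'⟩)
  · exact hpr (hxx p (by simp) r (by simp) hpq hqr.symm ⟨_, h1', h1⟩ ⟨_, h2, h2'⟩)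
  · exact hpq (hxx p (by simp) q (by simp) hpr hqr ⟨_, h3', h3⟩ ⟨_, h2', h2⟩)

end Net

end TropicalDescendant

/-! ### Edges running over vertices, and how two similar nets can differ there -/

namespace TropicalDescendant
namespace Net

variable {N N' : Net}

lemma HasEdge.symm {p q : ℝ × ℝ} {a : ℕ} (h : N.HasEdge p q a) : N.HasEdge q p a := by
  obtain ⟨e, h1, h2, h3⟩ := h
  exact ⟨e, h2, h1, h3⟩

lemma PassLine.neg {p u : ℝ × ℝ} (h : N.PassLine p u) : N.PassLine p (-u) := by
  obtain ⟨e, h1, h2, h3⟩ := h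
  exact ⟨e, h1, h2, h3.neg h2⟩

lemma passLine_smul {p u : ℝ × ℝ} {c : ℝ} (hc : c ≠ 0) :
    N.PassLine p (c • u) ↔ N.PassLine p u := by
  have key : ∀ (c : ℝ) (u : ℝ × ℝ), c ≠ 0 → N.PassLine p u → N.PassLine p (c • u) := by
    intro c u hc h
    rcases lt_or_gt_of_ne hc with h0 | h0
    · obtain ⟨e, h1, h2, h3⟩ := h.neg
      refine ⟨e, h1, h2, ?_⟩
      have := h3.smul (neg_pos.2 h0)
      rwa [smul_neg, neg_smul, neg_neg] at this
    · obtain ⟨e, h1, h2, h3⟩ := h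
      exact ⟨e, h1, h2, h3.smul h0⟩
  refine ⟨fun h => ?_, key c u hc⟩
  have := key c⁻¹ _ (inv_ne_zero hc) h
  rwa [smul_smul, inv_mul_cancel₀ hc, one_smul] at this

/-- If some edge runs over the vertex `p`, then there is only one edge at `p` along this line, and
its other end point `q` is an end point of all the edges that run over `p`. -/
lemma PassLine.exists_unique_at {p u : ℝ × ℝ} (hp : p ∈ N.verts) (hu : u ≠ 0)
    (h : N.PassLine p u) : ∃ q e', q ≠ p ∧ (∃ c : ℝ, c ≠ 0 ∧ q - p = c • u) ∧ N.At p e' ∧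
      N.At q e' ∧ e' ∉ N.cov p (p - q) ∧ (N.cov p (q - p)).val = e' ::ₘ (N.cov p (p - q)).val ∧
      (N.cov p (p - q)).Nonempty ∧ ∀ e ∈ N.cov p (p - q), N.At q e ∧ ¬ N.At p e := by
  obtain ⟨e, h1, h2, h3⟩ := h
  obtain ⟨e', h1', h2'⟩ := N.vertex_on_edge hp h1
  obtain ⟨q, hq, hq'⟩ := N.overlap (by rintro rfl; exact h2 h1') h2'
  have hqp : q ≠ p := fun hqp => h2 (hqp ▸ hq')
  have hqp' : q - p ≠ 0 := sub_ne_zero.2 hqp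
  have he'q : N.Covers e' p (q - p) := covers_sub h1'.mem_img hq.mem_img
  have he : N.Covers e p (q - p) := covers_sub h1 hq'.mem_img
  have hen : N.Covers e p (p - q) := by simpa using he.neg h2
  -- every edge at `p` on the line is `e'`
  have huniq : ∀ g, N.At p g → N.Covers g p (q - p) ∨ N.Covers g p (p - q) → g = e' := by
    intro g hg hc
    have hge : g ≠ e := fun hge => h2 (hge ▸ hg)
    -- The edges g and e overlap on one side of p, so they share a vertex r. If r = q, then g and
    -- `e'` are parallel edges of the forest; otherwise p, q, r form a triangle.
    have : ∃ r, N.At r g ∧ N.At r e := by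
      rcases hc with hc | hc
      · exact exists_common hqp' hge hc he
      · exact exists_common (sub_ne_zero.2 hqp.symm) hge hc hen
    obtain ⟨r, hr, hr'⟩ := this
    have hrp : r ≠ p := fun hrp => h2 (hrp ▸ hr')
    by_cases hrq : r = q
    · subst hrq
      exact N.double hqp.symm hg hr h1' hq
    · exact (no_triangle hrp.symm hrq hqp.symm hg hr hr' hq' h1' hq).elim
  have he'n : ¬ N.Covers e' p (p - q) := by
    rw [← neg_sub q p]
    exact not_covers_neg h1' hqp' he'q
  have hnot : ∀ g ∈ N.cov p (p - q), ¬ N.At p g := by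
    intro g hg hpg
    rw [mem_cov] at hg
    obtain rfl := huniq g hpg (Or.inr hg)
    exact he'n hg
  refine ⟨q, e', hqp, h3.parallel hu hqp' he, h1', hq, by simpa using he'n, ?_,
    ⟨e, by simpa using hen⟩, fun g hg => ⟨?_, hnot g hg⟩⟩
  · have : N.cov p (q - p) = Finset.cons e' (N.cov p (p - q)) (by simpa using he'n) := by
      ext g
      simp only [mem_cov, Finset.mem_cons]
      constructor
      · intro hg
        by_cases hpg : N.At p g
        · exact Or.inl (huniq g hpg (Or.inl hg))
        · right
          simpa using hg.neg hpg
      · rintro (rfl | hg)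
        · exact he'q
        · simpa using hg.neg (hnot g (by simpa using hg))
    rw [this, Finset.cons_val]
  · have hpg := hnot g hg
    rw [mem_cov] at hg
    have hg' : N.Covers g p (q - p) := by simpa using hg.neg hpg
    obtain ⟨r, hr, hr'⟩ := exists_common hqp' (by rintro rfl; exact hpg h1') he'q hg'
    rcases h1'.eq_or_eq hqp.symm hq hr with rfl | rfl
    · exact absurd hr' hpg
    · exact hr'

/-- The uniqueness part of `PassLine.exists_unique_at`, freed from the choice of the side on which q
lies. -/
lemma PassLine.eq_of_at {p u : ℝ × ℝ} (hp : p ∈ N.verts) (hu : u ≠ 0) (h : N.PassLine p u)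
    {e e₂ : N.E} (he : N.At p e) (he₂ : N.At p e₂) (hc : N.Covers e p u ∨ N.Covers e p (-u))
    (hc₂ : N.Covers e₂ p u ∨ N.Covers e₂ p (-u)) : e = e₂ := by
  obtain ⟨q, e', hqp, ⟨d, hd, hq⟩, g1, g2, g3, g4, g5, g6⟩ := h.exists_unique_at hp hu
  have key : ∀ e, N.At p e → N.Covers e p u ∨ N.Covers e p (-u) → e = e' := by
    intro e hpe hce
    have hmem : e ∈ N.cov p (q - p) ∨ e ∈ N.cov p (p - q) := by
      rw [← neg_sub q p, hq]
      rcases lt_or_gt_of_ne hd with h0 | h0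
      · rw [← neg_smul, cov_smul (neg_pos.2 h0), ← neg_neg (d • u), ← neg_smul, ← smul_neg,
          cov_smul (neg_pos.2 h0), mem_cov, mem_cov]
        exact hce.symm
      · rw [← smul_neg, cov_smul h0, cov_smul h0, mem_cov, mem_cov]
        exact hce
    rcases hmem with hmem | hmem
    · rw [← Finset.mem_val, g4, Multiset.mem_cons] at hmem
      exact hmem.elim id fun h => absurd hpe (g6 e h).2
    · exact absurd hpe (g6 e hmem).2
  rw [key e he hc, key e₂ he₂ hc₂]

/-- The data that two simple curves with the same labelled image and the same marked points
share. -/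
structure Similar (N N' : Net) : Prop where
  verts_eq : N.verts = N'.verts
  label_eq : ∀ p u, u ≠ 0 → (N.cov p u).val.map N.wt = (N'.cov p u).val.map N'.wt
  card_at : ∀ p, Nat.card {e // N.At p e} = Nat.card {e // N'.At p e}

lemma Similar.symm (h : Similar N N') : Similar N' N :=
  ⟨h.verts_eq.symm, fun p u hu => (h.label_eq p u hu).symm, fun p => (h.card_at p).symm⟩

lemma Similar.card_cov (h : Similar N N') {p u : ℝ × ℝ} (hu : u ≠ 0) :
    (N.cov p u).card = (N'.cov p u).card := by
  have := congrArg Multiset.card (h.label_eq p u hu)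
  simpa using this

lemma exists_nearest_vertex {p v : ℝ × ℝ} (hv : v ≠ 0) (h : p + v ∈ N.verts) :
    ∃ s : ℝ, 0 < s ∧ s ≤ 1 ∧ p + s • v ∈ N.verts ∧
      ∀ t, 0 < t → t < s → p + t • v ∉ N.verts := by
  have hfin : {s : ℝ | 0 < s ∧ s ≤ 1 ∧ p + s • v ∈ N.verts}.Finite := by
    refine (N.finite_verts.preimage (f := fun s : ℝ => p + s • v) ?_).subset fun s hs => hs.2.2
    intro s _ t _ hst
    exact smul_left_injective ℝ hv (add_left_cancel hst)
  obtain ⟨s, ⟨h0, h1, h2⟩, hmin⟩ := Set.exists_min_image _ id hfin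
    ⟨1, one_pos, le_rfl, by simpa using h⟩
  exact ⟨s, h0, h1, h2, fun t ht hts hmem =>
    absurd (hmin t ⟨ht, hts.le.trans h1, hmem⟩) (not_le.2 hts)⟩

/-- `N` and `N'` differ at `p` along the direction `u`. -/
def Switched (N N' : Net) (p u : ℝ × ℝ) : Prop :=
  p ∈ N.verts ∧ u ≠ 0 ∧ N.PassLine p u ∧ ¬ N'.PassLine p u

/-- All edges of `N'` leaving p towards v start at p and reach the next vertex Q. Since parallel
edges are excluded, at most one of them ends at Q, so another runs over Q. The one ending there
makes the side of Q facing p heavier by one edge. -/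
lemma Similar.switch_nearest (h : Similar N N') {p v : ℝ × ℝ} (hv : v ≠ 0)
    (hn : ¬ N'.PassLine p v) (hk : 2 ≤ (N'.cov p v).card) {s : ℝ} (hs : 0 < s)
    (hQ : p + s • v ∈ N.verts) (hno : ∀ t, 0 < t → t < s → p + t • v ∉ N.verts) :
    ∃ f, N'.At p f ∧ N'.At (p + s • v) f ∧ N'.PassLine (p + s • v) v ∧
      (N'.cov (p + s • v) (-v)).card = (N'.cov (p + s • v) v).card + 1 := by
  set Q := p + s • v with hQdef
  have hQ' : Q ∈ N'.verts := h.verts_eq ▸ hQ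
  have hpQ : p ≠ Q := by
    intro hpQ
    have : s • v = 0 := by rw [hQdef] at hpQ; simpa using hpQ
    rw [smul_eq_zero] at this
    exact this.elim hs.ne' hv
  have hcov : N'.cov Q (-v) = N'.cov p v := cov_transport hs (h.verts_eq ▸ hno)
  have hat : ∀ f ∈ N'.cov p v, N'.At p f := by
    intro f hf
    rw [mem_cov] at hf
    by_contra hpf
    exact hn ⟨f, hf.1, hpf, hf⟩
  obtain ⟨f₁, hf₁, f₂, hf₂, hne⟩ := Finset.one_lt_card.1 (show 1 < _ from hk)
  have hvn : -v ≠ 0 := neg_ne_zero.2 hv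
  have hQimg : ∀ f ∈ N'.cov p v, N'.Covers f Q (-v) := by
    intro f hf
    rw [← hcov, mem_cov] at hf
    exact hf
  -- If none ended at Q, all would run over Q. The unique edge at Q on the line cannot lead towards
  -- p, being then one of them; if it leads away, two of them join p to its other end.
  have hone : ∃ f, f ∈ N'.cov p v ∧ N'.At Q f := by
    by_contra! hnone
    have hpl : N'.PassLine Q (-v) := ⟨f₁, (hQimg _ hf₁).1, hnone _ hf₁, hQimg _ hf₁⟩
    obtain ⟨r, e'', hrQ, ⟨c, hc, hrc⟩, h1, h2, h3, h4, h5, h6⟩ := hpl.exists_unique_at hQ' hvn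
    rcases lt_or_gt_of_ne hc with hc0 | hc0
    · have : N'.cov Q (Q - r) = N'.cov p v := by
        rw [← hcov, ← neg_sub r Q, hrc, ← neg_smul, cov_smul (neg_pos.2 hc0)]
      rw [this] at h6
      have hrp : r = p := by
        by_contra hrp
        exact hne (N'.double (Ne.symm hrp) (hat _ hf₁) (h6 _ hf₁).1 (hat _ hf₂) (h6 _ hf₂).1)
      have h7 : (s - c) • v = 0 := by
        have : p - Q = -(s • v) := by rw [hQdef]; abel
        rw [hrp, this, smul_neg, neg_inj] at hrc
        rw [sub_smul, hrc, sub_self]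
      rw [smul_eq_zero] at h7
      exact h7.elim (fun h => by linarith) hv
    · have : N'.cov Q (r - Q) = N'.cov p v := by
        rw [← hcov, hrc, cov_smul hc0]
      rw [this] at h4
      exact hnone e'' (by rw [← Finset.mem_val, h4]; simp) h1
  obtain ⟨f, hf, hfQ⟩ := hone
  obtain ⟨g, hg, hgf⟩ : ∃ g ∈ N'.cov p v, g ≠ f := by
    by_cases h12 : f₁ = f
    · exact ⟨f₂, hf₂, fun h => hne (h12.trans h.symm)⟩
    · exact ⟨f₁, hf₁, h12⟩
  have hgQ : ¬ N'.At Q g := fun hgQ => hgf (N'.double hpQ (hat g hg) hgQ (hat f hf) hfQ)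
  have hpl : N'.PassLine Q (-v) := ⟨g, (hQimg _ hg).1, hgQ, hQimg _ hg⟩
  refine ⟨f, hat f hf, hfQ, by simpa using hpl.neg, ?_⟩
  obtain ⟨r, e'', hrQ, ⟨c, hc, hrc⟩, h1, h2, h3, h4, h5, h6⟩ := hpl.exists_unique_at hQ' hvn
  rcases lt_or_gt_of_ne hc with hc0 | hc0
  · have : N'.cov Q (Q - r) = N'.cov p v := by
      rw [← hcov, ← neg_sub r Q, hrc, ← neg_smul, cov_smul (neg_pos.2 hc0)]
    rw [this] at h6
    exact absurd hfQ (h6 f hf).2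
  · have e1 : N'.cov Q (r - Q) = N'.cov Q (-v) := by rw [hrc, cov_smul hc0]
    have e2 : N'.cov Q (Q - r) = N'.cov Q v := by
      rw [← neg_sub r Q, hrc, smul_neg, neg_neg, cov_smul hc0]
    rw [e1, e2] at h4
    have := congrArg Multiset.card h4
    simpa using this

/-- In `N`, the edge `e'` from p to q and an edge `e₂` running over p both end at q. The next vertex
after p must be q itself, and there `switch_nearest` describes `N'`. -/
lemma Similar.switch (h : Similar N N') {p u : ℝ × ℝ} (hs : Switched N N' p u) :
    ∃ q, q ≠ p ∧ (∃ c : ℝ, c ≠ 0 ∧ q - p = c • u) ∧ (∃ e, N.At p e ∧ N.At q e) ∧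
      (∃ e, N'.At p e ∧ N'.At q e) ∧ Switched N' N q u := by
  obtain ⟨hp, hu, hpl, hnpl⟩ := hs
  obtain ⟨q, e', hqp, ⟨c, hc, hqc⟩, h1, h2, h3, h4, h5, h6⟩ := hpl.exists_unique_at hp hu
  set v := q - p with hv
  have hv0 : v ≠ 0 := sub_ne_zero.2 hqp
  have hnv : p - q = -v := by rw [hv, neg_sub]
  rw [hnv] at h3 h4 h5 h6
  have hn' : ¬ N'.PassLine p v := by rwa [hqc, passLine_smul hc]
  obtain ⟨e₂, he₂⟩ := h5
  have he₂' : N.Covers e₂ p v := by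
    have := (mem_cov.1 he₂).neg (h6 _ he₂).2
    simpa using this
  have he' : N.Covers e' p v := covers_sub h1.mem_img h2.mem_img
  have hne : e' ≠ e₂ := fun heq => h3 (heq ▸ he₂)
  have hk : 2 ≤ (N.cov p v).card :=
    Finset.one_lt_card.2 ⟨e', by simpa using he', e₂, by simpa using he₂', hne⟩
  have hpv : p + v = q := by rw [hv, add_sub_cancel]
  obtain ⟨s, hs0, hs1, hQ, hno⟩ := N.exists_nearest_vertex hv0 (p := p)
    (by rw [hpv]; exact N.at_mem h2)
  obtain ⟨f, hf1, hf2, hf3, hf4⟩ := h.switch_nearest hv0 hn' (h.card_cov hv0 ▸ hk) hs0 hQ hno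
  -- A vertex Q strictly before q is run over in `N` by `e'` and `e₂`. If the edge at Q led back,
  -- both would end at its other end, which is p, but `e₂` does not. If it led forward, the forward
  -- side would be the heavier one, whereas `switch_nearest` says the opposite of the same labels.
  have hs1' : s = 1 := by
    by_contra hs1'
    have hlt : s < 1 := lt_of_le_of_ne hs1 hs1'
    set Q := p + s • v with hQdef
    have hQp : Q - p = s • v := by rw [hQdef, add_sub_cancel_left]
    have hQq : q - Q = (1 - s) • v := by rw [hQdef, ← hpv]; module
    have hsv : s • v ≠ 0 := smul_ne_zero hs0.ne' hv0
    have hsv' : (1 - s) • v ≠ 0 := smul_ne_zero (sub_pos.2 hlt).ne' hv0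
    have hQne : Q ≠ p := sub_ne_zero.1 (hQp ▸ hsv)
    have hQne' : q ≠ Q := sub_ne_zero.1 (hQq ▸ hsv')
    have hcov : ∀ e, p ∈ N.img e → N.At q e → N.Covers e Q v ∧ N.Covers e Q (-v) :=
      fun e hpe hqe => covers_between hpe
        (by rw [one_smul, hpv]; exact hqe.mem_img) hs0 hlt
    have hQe' : ¬ N.At Q e' := by
      intro hat
      rcases h1.eq_or_eq hqp.symm h2 hat with h | h
      · exact hQne h
      · exact hQne' h.symm
    have hplQ : N.PassLine Q v := ⟨e', (hcov e' h1.mem_img h2).1.1, hQe', (hcov e' h1.mem_img h2).1⟩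
    obtain ⟨r, e'', hrQ, ⟨b, hb, hrb⟩, g1, g2, g3, g4, g5, g6⟩ := hplQ.exists_unique_at hQ hv0
    rcases lt_or_gt_of_ne hb with hb0 | hb0
    · have hc1 : N.cov Q (Q - r) = N.cov Q v := by
        rw [← neg_sub r Q, hrb, ← neg_smul, cov_smul (neg_pos.2 hb0)]
      rw [hc1] at g4 g6
      have hre' := (g6 e' (by simpa using (hcov e' h1.mem_img h2).1)).1
      have hrp : r = p := by
        rcases h1.eq_or_eq hqp.symm h2 hre' with h | h
        · exact h
        · exfalso
          rw [h, hQq] at hrb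
          have := smul_left_injective ℝ hv0 hrb
          linarith
      have h7 := (g6 e₂ (by simpa using (hcov e₂ he₂'.1 (h6 _ he₂).1).1)).1
      exact (h6 _ he₂).2 (hrp ▸ h7)
    · have hc1 : N.cov Q (r - Q) = N.cov Q v := by rw [hrb, cov_smul hb0]
      have hc2 : N.cov Q (Q - r) = N.cov Q (-v) := by
        rw [← neg_sub r Q, hrb, ← smul_neg, cov_smul hb0]
      rw [hc1, hc2] at g4
      have := congrArg Multiset.card g4
      simp only [Multiset.card_cons, Finset.card_val] at this
      rw [h.card_cov hv0, h.card_cov (neg_ne_zero.2 hv0)] at this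
      omega
  subst hs1'
  rw [one_smul, hpv] at hf2 hf3
  refine ⟨q, hqp, ⟨c, hc, hqc⟩, ⟨e', h1, h2⟩, ⟨f, hf1, hf2⟩, N'.at_mem hf2, hu, ?_, ?_⟩
  · rwa [hqc, passLine_smul hc] at hf3
  · intro hcon
    rw [← passLine_smul hc, ← hqc] at hcon
    -- If the line were run over at q in `N`, then `e'` and `e₂`, both ending at q on it, would
    -- coincide.
    refine hne (hcon.eq_of_at (N.at_mem h2) hv0 h2 (h6 _ he₂).1 (Or.inr ?_) (Or.inr ?_))
    · rw [← hnv]; exact covers_sub h2.mem_img h1.mem_img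
    · rw [← hnv]; exact covers_sub (h6 _ he₂).1.mem_img he₂'.1

end Net
end TropicalDescendant

/-! ### Similar nets have the same passing lines, bounded edges and unbounded edges -/

namespace TropicalDescendant
namespace Net

variable {N N' : Net}

open Classical in
/-- The edges that start at `p` in direction `u`. -/
noncomputable def atCov (N : Net) (p u : ℝ × ℝ) : Finset N.E := {e | N.At p e ∧ N.Covers e p u}

@[simp] lemma mem_atCov {p u : ℝ × ℝ} {e : N.E} :
    e ∈ N.atCov p u ↔ N.At p e ∧ N.Covers e p u := by
  simp [atCov]

lemma atCov_subset (p u : ℝ × ℝ) : N.atCov p u ⊆ N.cov p u := fun _ he =>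
  mem_cov.2 (mem_atCov.1 he).2

lemma atCov_eq_cov {p u : ℝ × ℝ} (h : ¬ N.PassLine p u) : N.atCov p u = N.cov p u := by
  refine (atCov_subset p u).antisymm fun e he => ?_
  rw [mem_cov] at he
  rw [mem_atCov]
  refine ⟨?_, he⟩
  by_contra hn
  exact h ⟨e, he.1, hn, he⟩

lemma PassLine.card_atCov_lt {p u : ℝ × ℝ} (h : N.PassLine p u) :
    (N.atCov p u).card < (N.cov p u).card := by
  obtain ⟨e, h1, h2, h3⟩ := h
  refine Finset.card_lt_card ((Finset.ssubset_iff_of_subset (atCov_subset p u)).2 ⟨e, ?_, ?_⟩)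
  · simpa using h3
  · simp [h2]

/-- On a line that is run over, the single edge at p lies on the side whose germ has one more edge;
so labels alone tell how many edges start in each direction. -/
lemma PassLine.card_cases {p u : ℝ × ℝ} (hp : p ∈ N.verts) (hu : u ≠ 0) (h : N.PassLine p u) :
    ((N.cov p u).card = (N.cov p (-u)).card + 1 ∧ (N.atCov p u).card = 1) ∨
      ((N.cov p (-u)).card = (N.cov p u).card + 1 ∧ (N.atCov p u).card = 0) := by
  obtain ⟨q, e', hqp, ⟨d, hd, hq⟩, g1, g2, g3, g4, g5, g6⟩ := h.exists_unique_at hp hu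
  rw [← neg_sub q p, hq] at g3 g4 g6
  rcases lt_or_gt_of_ne hd with h0 | h0
  · right
    rw [← neg_smul, cov_smul (neg_pos.2 h0)] at g3 g4 g6
    rw [← neg_neg (d • u), ← neg_smul, ← smul_neg, cov_smul (neg_pos.2 h0)] at g4
    refine ⟨by simpa using congrArg Multiset.card g4, ?_⟩
    rw [Finset.card_eq_zero, Finset.eq_empty_iff_forall_notMem]
    intro e he
    exact (g6 e (atCov_subset p u he)).2 (mem_atCov.1 he).1
  · left
    rw [← smul_neg, cov_smul h0] at g3 g4 g6
    rw [cov_smul h0] at g4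
    refine ⟨by simpa using congrArg Multiset.card g4, ?_⟩
    rw [Finset.card_eq_one]
    refine ⟨e', Finset.eq_singleton_iff_unique_mem.2 ⟨?_, ?_⟩⟩
    · rw [mem_atCov, ← mem_cov, ← Finset.mem_val, g4]
      exact ⟨g1, by simp⟩
    · intro e he
      have := atCov_subset p u he
      rw [← Finset.mem_val, g4, Multiset.mem_cons] at this
      exact this.resolve_right fun h => (g6 e h).2 (mem_atCov.1 he).1

lemma Similar.card_atCov_eq (h : Similar N N') {p u : ℝ × ℝ} (hp : p ∈ N.verts) (hu : u ≠ 0)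
    (hiff : N.PassLine p u ↔ N'.PassLine p u) : (N.atCov p u).card = (N'.atCov p u).card := by
  have h1 := h.card_cov (p := p) hu
  have h2 := h.card_cov (p := p) (neg_ne_zero.2 hu)
  by_cases hpl : N.PassLine p u
  · have h3 := hpl.card_cases hp hu
    have h4 := (hiff.1 hpl).card_cases (h.verts_eq ▸ hp) hu
    omega
  · rw [atCov_eq_cov hpl, atCov_eq_cov (fun h => hpl (hiff.2 h)), h1]

/-- Norm-one representatives serve to sort the edges at p by direction. Edges not at p receive a
dummy value. -/
lemma exists_unit_dir (N : Net) (p : ℝ × ℝ) (e : N.E) : ∃ D : ℝ × ℝ, ‖D‖ = 1 ∧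
    (N.At p e → ∀ u : ℝ × ℝ, ‖u‖ = 1 → (N.Covers e p u ↔ D = u)) := by
  by_cases h : N.At p e
  · obtain ⟨D, hD, hf⟩ := exists_dir_of_at h
    have hD' : 0 < ‖D‖ := norm_pos_iff.2 hD
    refine ⟨‖D‖⁻¹ • D, by rw [norm_smul, norm_inv, norm_norm, inv_mul_cancel₀ hD'.ne'],
      fun _ u hu => ?_⟩
    have hu0 : u ≠ 0 := by rintro rfl; simp at hu
    rw [hf u hu0]
    constructor
    · rintro ⟨c, hc, rfl⟩
      rw [norm_smul, Real.norm_of_nonneg hc.le] at hu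
      rw [eq_inv_of_mul_eq_one_left hu]
    · rintro rfl
      exact ⟨_, inv_pos.2 hD', rfl⟩
  · exact ⟨(1, 0), by simp, fun h' => absurd h' h⟩

/-- Running over p lowers the number of edges starting in that direction, for a given label. If no
line differed the opposite way, `N` would have at most as many starting edges as `N'` in each
direction and strictly fewer along u, against the equal valences. -/
lemma Similar.exists_switched (h : Similar N N') {p u : ℝ × ℝ} (hs : Switched N N' p u) :
    ∃ u', Switched N' N p u' := by
  classical
  obtain ⟨hp, hu, hpl, hnpl⟩ := hs
  by_contra! hno
  have himp : ∀ w, w ≠ 0 → N'.PassLine p w → N.PassLine p w := by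
    intro w hw h1
    by_contra h2
    exact hno w ⟨h.verts_eq ▸ hp, hw, h1, h2⟩
  have hle : ∀ w, w ≠ 0 → (N.atCov p w).card ≤ (N'.atCov p w).card := by
    intro w hw
    by_cases hw' : N'.PassLine p w
    · exact (h.card_atCov_eq hp hw ⟨fun _ => hw', himp w hw⟩).le
    · rw [atCov_eq_cov hw', ← h.card_cov hw]
      exact Finset.card_le_card (atCov_subset p w)
  choose D hD hD' using N.exists_unit_dir p
  choose F hF hF' using N'.exists_unit_dir p
  set c : ℝ := ‖u‖⁻¹
  have hc : 0 < c := inv_pos.2 (norm_pos_iff.2 hu)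
  -- The normalized u is included so that the strict inequality is a term of the sum.
  let T : Finset (ℝ × ℝ) := insert (c • u) (Finset.univ.image D ∪ Finset.univ.image F)
  have hcu : ‖c • u‖ = 1 := by
    rw [norm_smul, Real.norm_of_nonneg hc.le, inv_mul_cancel₀ (norm_pos_iff.2 hu).ne']
  have hT : ∀ w ∈ T, ‖w‖ = 1 := by
    intro w hw
    simp only [T, Finset.mem_insert, Finset.mem_union, Finset.mem_image, Finset.mem_univ,
      true_and] at hw
    rcases hw with rfl | ⟨e, rfl⟩ | ⟨e, rfl⟩
    exacts [hcu, hD e, hF e]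
  have e1 : Nat.card {e // N.At p e} = ∑ w ∈ T, (N.atCov p w).card := by
    rw [Nat.card_eq_fintype_card, Fintype.card_subtype,
      Finset.card_eq_sum_card_fiberwise (f := D) (t := T) (by intro e _; simp [T])]
    refine Finset.sum_congr rfl fun w hw => congrArg _ ?_
    ext e
    simp only [Finset.mem_filter, Finset.mem_univ, true_and, mem_atCov]
    exact and_congr_right fun hat => (hD' e hat w (hT w hw)).symm
  have e2 : Nat.card {e // N'.At p e} = ∑ w ∈ T, (N'.atCov p w).card := by
    rw [Nat.card_eq_fintype_card, Fintype.card_subtype,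
      Finset.card_eq_sum_card_fiberwise (f := F) (t := T) (by intro e _; simp [T])]
    refine Finset.sum_congr rfl fun w hw => congrArg _ ?_
    ext e
    simp only [Finset.mem_filter, Finset.mem_univ, true_and, mem_atCov]
    exact and_congr_right fun hat => (hF' e hat w (hT w hw)).symm
  have hlt : ∑ w ∈ T, (N.atCov p w).card < ∑ w ∈ T, (N'.atCov p w).card := by
    refine Finset.sum_lt_sum (fun w hw => hle w ?_) ⟨c • u, by simp [T], ?_⟩
    · intro h0
      have := hT w hw
      simp [h0] at this
    · have h3 : N.PassLine p (c • u) := (passLine_smul hc.ne').2 hpl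
      have h4 : ¬ N'.PassLine p (c • u) := fun h => hnpl ((passLine_smul hc.ne').1 h)
      rw [atCov_eq_cov h4, ← h.card_cov (smul_ne_zero hc.ne' hu)]
      exact h3.card_atCov_lt
  have := h.card_at p
  omega

/-- At a leaf of the set of differing vertices there are switches in both senses. Their partners are
both neighbours in `N`, hence equal, so the two lines agree; but one line cannot be run over in
exactly `N` and in exactly `N'`. -/
lemma Similar.not_switched (h : Similar N N') (p u : ℝ × ℝ) : ¬ Switched N N' p u := by
  intro hs
  obtain ⟨x, ⟨u, hx⟩, hxx⟩ := N.leaf {x | ∃ u, Switched N N' x u ∨ Switched N' N x u} (by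
    rintro x ⟨u, hx | hx⟩
    · exact hx.1
    · rw [h.verts_eq]; exact hx.1) ⟨p, u, Or.inl hs⟩
  obtain ⟨⟨u₁, h1⟩, ⟨u₂, h2⟩⟩ : (∃ u, Switched N N' x u) ∧ ∃ u, Switched N' N x u := by
    rcases hx with hx | hx
    · exact ⟨⟨u, hx⟩, h.exists_switched hx⟩
    · exact ⟨h.symm.exists_switched hx, ⟨u, hx⟩⟩
  obtain ⟨q₁, hq₁, ⟨c₁, hc₁, hd₁⟩, hE₁, -, hs₁⟩ := h.switch h1
  obtain ⟨q₂, hq₂, ⟨c₂, hc₂, hd₂⟩, -, hE₂, hs₂⟩ := h.symm.switch h2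
  have heq := hxx q₁ ⟨u₁, Or.inr hs₁⟩ q₂ ⟨u₂, Or.inl hs₂⟩ hq₁ hq₂ hE₁ hE₂
  rw [← heq] at hd₂
  have h3 := (passLine_smul hc₁).2 h1.2.2.1
  rw [← hd₁, hd₂, passLine_smul hc₂] at h3
  exact h2.2.2.2 h3

lemma Similar.passLine_iff (h : Similar N N') {p u : ℝ × ℝ} (hp : p ∈ N.verts) (hu : u ≠ 0) :
    N.PassLine p u ↔ N'.PassLine p u := by
  constructor
  · intro h1
    by_contra h2
    exact h.not_switched p u ⟨hp, hu, h1, h2⟩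
  · intro h1
    by_contra h2
    exact h.symm.not_switched p u ⟨h.verts_eq ▸ hp, hu, h1, h2⟩

lemma exists_end_of_notMem {p v : ℝ × ℝ} {f : N.E} (hp : N.At p f) (hv : v ≠ 0)
    (hc : N.Covers f p v) (hn : p + v ∉ N.img f) :
    ∃ c : ℝ, 0 < c ∧ c < 1 ∧ N.At (p + c • v) f := by
  obtain ⟨D, hD, hf⟩ := form_of_at hp
  have hcD : N.Covers f p D := by
    refine ⟨hp.mem_img, 1, one_pos, ?_⟩
    rcases hf with ⟨h1, -⟩ | ⟨h1, -⟩
    · exact (h1 _).2 ⟨1, zero_le_one, le_rfl, rfl⟩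
    · exact (h1 _).2 ⟨1, zero_le_one, rfl⟩
  obtain ⟨c, hc0, rfl⟩ := hc.pos_parallel hp hv hD hcD
  rcases hf with ⟨h1, h2⟩ | ⟨h1, -⟩
  · refine ⟨c, hc0, ?_, (h2 _).2 (Or.inr rfl)⟩
    by_contra! hle
    exact hn ((h1 _).2 ⟨c⁻¹, by positivity, inv_le_one_of_one_le₀ hle,
      by rw [smul_smul, inv_mul_cancel₀ hc0.ne', one_smul]⟩)
  · exact absurd ((h1 _).2 ⟨c⁻¹, by positivity,
      by rw [smul_smul, inv_mul_cancel₀ hc0.ne', one_smul]⟩) hn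

lemma Covers.or_neg_of_smul {e : N.E} {p u : ℝ × ℝ} {c : ℝ} (hc : c ≠ 0)
    (h : N.Covers e p (c • u)) : N.Covers e p u ∨ N.Covers e p (-u) := by
  rcases lt_or_gt_of_ne hc with h0 | h0
  · right
    rwa [← neg_neg (c • u), ← neg_smul, ← smul_neg, covers_smul_iff (neg_pos.2 h0)] at h
  · left
    rwa [covers_smul_iff h0] at h

lemma PassLine.of_edge {p q : ℝ × ℝ} {e : N.E} (hpq : p ≠ q) (hep : N.At p e) (heq : N.At q e)
    (h : N.PassLine p (q - p)) : (N.cov p (q - p)).val = e ::ₘ (N.cov p (p - q)).val ∧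
      (N.cov p (p - q)).Nonempty ∧ ∀ g ∈ N.cov p (p - q), N.At q g ∧ ¬ N.At p g := by
  have hp := N.at_mem hep
  have hv0 : q - p ≠ 0 := sub_ne_zero.2 hpq.symm
  obtain ⟨r, e', hrp, ⟨c, hc, hrc⟩, g1, g2, g3, g4, g5, g6⟩ := h.exists_unique_at hp hv0
  have hpr : N.Covers e' p (r - p) := covers_sub g1.mem_img g2.mem_img
  rw [hrc] at hpr
  obtain rfl := h.eq_of_at hp hv0 hep g1 (Or.inl (covers_sub hep.mem_img heq.mem_img))
    (hpr.or_neg_of_smul hc)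
  obtain rfl := (hep.eq_or_eq hpq heq g2).resolve_left hrp
  exact ⟨g4, g5, g6⟩

/-- On a line run over at p, the labels on the two sides differ by the weight of the one edge at p,
so in `N'` that edge has the same side and weight; only its length is open. A shorter one
contradicts minimality. A longer one runs over q in `N'`, hence q is run over in `N`, although two
edges of `N` end at q from the side of p. -/
lemma Similar.not_passLine_of_minimal (h : Similar N N') {p q : ℝ × ℝ} {a : ℕ} (hpq : p ≠ q)
    (hmin : ∀ x y b, x ≠ y → dist x y < dist p q → (N.HasEdge x y b ↔ N'.HasEdge x y b))
    (h1 : N.HasEdge p q a) (h2 : ¬ N'.HasEdge p q a) : ¬ N.PassLine p (q - p) := by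
  intro hpl
  obtain ⟨e, hep, heq, hea⟩ := h1
  have hp := N.at_mem hep
  have hq := N.at_mem heq
  obtain ⟨k1, ⟨g, hg⟩, k3⟩ := hpl.of_edge hpq hep heq
  set v := q - p with hv
  have hv0 : v ≠ 0 := sub_ne_zero.2 hpq.symm
  have hnv : p - q = -v := by rw [hv, neg_sub]
  rw [hnv] at k1 hg k3
  have hpv : p + v = q := by rw [hv, add_sub_cancel]
  have hev : N.Covers e p v := covers_sub hep.mem_img heq.mem_img
  obtain ⟨r, e'', hrp, ⟨c, hc, hrc⟩, g1, g2, g3, g4, g5, g6⟩ :=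
    ((h.passLine_iff hp hv0).1 hpl).exists_unique_at (h.verts_eq ▸ hp) hv0
  rw [← neg_sub r p, hrc] at g3 g4 g5 g6
  have l1 := h.label_eq p v hv0
  have l2 := h.label_eq p (-v) (neg_ne_zero.2 hv0)
  rw [k1, Multiset.map_cons, l2] at l1
  have hc0 : 0 < c := by
    rcases lt_or_gt_of_ne hc with h0 | h0
    · exfalso
      rw [← neg_smul, cov_smul (neg_pos.2 h0)] at g4
      rw [← neg_neg (c • v), ← neg_smul, ← smul_neg, cov_smul (neg_pos.2 h0)] at g4
      have m1 := congrArg Multiset.card g4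
      have m2 := congrArg Multiset.card l1
      simp only [Multiset.card_cons, Multiset.card_map] at m1 m2
      omega
    · exact h0
  rw [← smul_neg, cov_smul hc0, cov_smul hc0] at g4
  rw [g4, Multiset.map_cons, Multiset.cons_inj_left, hea] at l1
  have hr : r = p + c • v := by rw [← hrc, add_sub_cancel]
  have hHas : N'.HasEdge p r a := ⟨e'', g1, g2, l1.symm⟩
  rcases lt_trichotomy c 1 with h0 | h0 | h0
  · have hd : dist p r < dist p q := by
      rw [hr, dist_self_add_right, ← hpv, dist_self_add_right, norm_smul,
        Real.norm_of_nonneg hc0.le]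
      exact mul_lt_of_lt_one_left (norm_pos_iff.2 hv0) h0
    obtain ⟨e₃, t1, t2, -⟩ := (hmin p r a hrp.symm hd).2 hHas
    have hc3 : N.Covers e₃ p (r - p) := covers_sub t1.mem_img t2.mem_img
    rw [hrc, covers_smul_iff hc0] at hc3
    obtain rfl := hpl.eq_of_at hp hv0 t1 hep (Or.inl hc3) (Or.inl hev)
    obtain rfl := (hep.eq_or_eq hpq heq t2).resolve_left hrp
    exact h2 hHas
  · rw [h0, one_smul, hpv] at hr
    exact h2 (hr ▸ hHas)
  · have hcov := covers_between (s := c) (t := 1) (u := v) g1.mem_img (hr ▸ g2.mem_img) one_pos h0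
    rw [one_smul, hpv] at hcov
    have hnat : ¬ N'.At q e'' := by
      intro hat
      rcases g1.eq_or_eq hrp.symm g2 hat with h3 | h3
      · exact hpq h3.symm
      · exact h2 (h3 ▸ hHas)
    have hpl' := (h.passLine_iff hq hv0).2 ⟨e'', hcov.1.1, hnat, hcov.1⟩
    have hge : g = e := by
      refine hpl'.eq_of_at hq hv0 (k3 g hg).1 heq (Or.inr ?_) (Or.inr ?_)
      · rw [← hnv]; exact covers_sub (k3 g hg).1.mem_img (mem_cov.1 hg).1
      · rw [← hnv]; exact covers_sub heq.mem_img hep.mem_img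
    exact (k3 g hg).2 (hge ▸ hep)

/-- With nothing running over p or q on this line, each weight-a edge of `N'` from p towards q stops
before q. By minimality it has a counterpart in `N`, different from e, so `N'` has fewer such edges
than `N`, against the labels. -/
lemma Similar.hasEdge_of_minimal (h : Similar N N') {p q : ℝ × ℝ} {a : ℕ} (hpq : p ≠ q)
    (hmin : ∀ x y b, x ≠ y → dist x y < dist p q → (N.HasEdge x y b ↔ N'.HasEdge x y b))
    (h1 : N.HasEdge p q a) : N'.HasEdge p q a := by
  classical
  by_contra h2
  have n1 := h.not_passLine_of_minimal hpq hmin h1 h2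
  have n2 := h.not_passLine_of_minimal hpq.symm
    (fun x y b hxy hd => hmin x y b hxy (by rwa [dist_comm p q])) h1.symm (fun h => h2 h.symm)
  obtain ⟨e, hep, heq, hea⟩ := h1
  have hp := N.at_mem hep
  have hq := N.at_mem heq
  have hv0 : q - p ≠ 0 := sub_ne_zero.2 hpq.symm
  have hv0' : p - q ≠ 0 := sub_ne_zero.2 hpq
  rw [h.passLine_iff hp hv0] at n1
  rw [h.passLine_iff hq hv0'] at n2
  set v := q - p with hv
  have hpv : p + v = q := by rw [hv, add_sub_cancel]
  have hev : N.Covers e p v := covers_sub hep.mem_img heq.mem_img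
  have hcard : ((N.cov p v).filter fun g => a = N.wt g).card =
      ((N'.cov p v).filter fun g => a = N'.wt g).card := by
    have := congrArg (Multiset.count a) (h.label_eq p v hv0)
    rwa [Multiset.count_map, Multiset.count_map] at this
  have hemem : e ∈ (N.cov p v).filter fun g => a = N.wt g := by simp [hev, hea]
  have hle : ((N'.cov p v).filter fun g => a = N'.wt g).card ≤
      (((N.cov p v).filter fun g => a = N.wt g).erase e).card := by
    -- Edges are matched by having the same two ends; this is injective because there are no
    -- parallel edges.
    refine Finset.card_le_card_of_forall_subsingleton
      (fun f g => ∃ x, x ≠ p ∧ N'.At x f ∧ N'.At p f ∧ N.At x g ∧ N.At p g) ?_ ?_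
    · intro f hf
      simp only [Finset.mem_filter, mem_cov] at hf
      obtain ⟨hfc, hfa⟩ := hf
      have hpf : N'.At p f := by
        by_contra hpf
        exact n1 ⟨f, hfc.1, hpf, hfc⟩
      have hqf : q ∉ N'.img f := by
        intro hqf
        refine n2 ⟨f, hqf, fun hat => h2 ⟨f, hpf, hat, hfa.symm⟩, covers_sub hqf hfc.1⟩
      obtain ⟨c, hc0, hc1, hat⟩ := exists_end_of_notMem hpf hv0 hfc (by rwa [hpv])
      have hne : p + c • v ≠ p := by
        simpa using ⟨hc0.ne', hv0⟩
      have hd : dist p (p + c • v) < dist p q := by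
        rw [dist_self_add_right, ← hpv, dist_self_add_right, norm_smul,
          Real.norm_of_nonneg hc0.le]
        exact mul_lt_of_lt_one_left (norm_pos_iff.2 hv0) hc1
      obtain ⟨g, hg1, hg2, hg3⟩ := (hmin _ _ a hne.symm hd).2 ⟨f, hpf, hat, hfa.symm⟩
      refine ⟨g, ?_, _, hne, hat, hpf, hg2, hg1⟩
      have hgc : N.Covers g p (p + c • v - p) := covers_sub hg1.mem_img hg2.mem_img
      rw [add_sub_cancel_left, covers_smul_iff hc0] at hgc
      simp only [Finset.mem_erase, Finset.mem_filter, mem_cov]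
      refine ⟨?_, hgc, hg3.symm⟩
      rintro rfl
      rcases hep.eq_or_eq hpq heq hg2 with h3 | h3
      · exact hne h3
      · rw [h3] at hat
        exact hqf hat.mem_img
    · rintro g - f₁ ⟨-, x, hx, k1, k2, k3, k4⟩ f₂ ⟨-, y, hy, m1, m2, m3, m4⟩
      obtain rfl : y = x := (k4.eq_or_eq hx.symm k3 m3).resolve_left hy
      exact N'.double hy k1 k2 m1 m2
  rw [Finset.card_erase_of_mem hemem, ← hcard] at hle
  have := Finset.card_pos.2 ⟨e, hemem⟩
  omega

lemma Similar.hasEdge_iff (h : Similar N N') {p q : ℝ × ℝ} {a : ℕ} (hpq : p ≠ q) :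
    N.HasEdge p q a ↔ N'.HasEdge p q a := by
  by_contra hcon
  let B : Set ((ℝ × ℝ) × (ℝ × ℝ)) :=
    {x | x.1 ≠ x.2 ∧ ∃ b, ¬ (N.HasEdge x.1 x.2 b ↔ N'.HasEdge x.1 x.2 b)}
  have hB : B.Finite := by
    refine (N.finite_verts.prod N.finite_verts).subset ?_
    rintro ⟨x, y⟩ ⟨-, b, hb⟩
    have : N.HasEdge x y b ∨ N'.HasEdge x y b := by tauto
    rcases this with ⟨e, h1, h2, -⟩ | ⟨e, h1, h2, -⟩
    · exact ⟨N.at_mem h1, N.at_mem h2⟩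
    · rw [h.verts_eq]; exact ⟨N'.at_mem h1, N'.at_mem h2⟩
  obtain ⟨⟨x, y⟩, ⟨hxy, b, hb⟩, hmin⟩ := Set.exists_min_image B (fun x => dist x.1 x.2) hB
    ⟨(p, q), hpq, a, hcon⟩
  have hmin' : ∀ x' y' b', x' ≠ y' → dist x' y' < dist x y →
      (N.HasEdge x' y' b' ↔ N'.HasEdge x' y' b') := by
    intro x' y' b' hne hd
    by_contra hc
    exact absurd (hmin (x', y') ⟨hne, b', hc⟩) (not_le.2 hd)
  exact hb ⟨h.hasEdge_of_minimal hxy hmin',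
    h.symm.hasEdge_of_minimal hxy fun x' y' b' h1 h2 => (hmin' x' y' b' h1 h2).symm⟩

open Classical in
lemma Similar.card_bounded_le (h : Similar N N') (p : ℝ × ℝ) {u : ℝ × ℝ} (hu : u ≠ 0) :
    ((N.atCov p u).filter fun e => ∃ q, q ≠ p ∧ N.At q e).card ≤
      ((N'.atCov p u).filter fun e => ∃ q, q ≠ p ∧ N'.At q e).card := by
  refine Finset.card_le_card_of_forall_subsingleton
      (fun f g => ∃ x, x ≠ p ∧ N.At x f ∧ N.At p f ∧ N'.At x g ∧ N'.At p g) ?_ ?_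
  · intro f hf
    simp only [Finset.mem_filter, mem_atCov] at hf
    obtain ⟨⟨h1, h2⟩, q, hqp, hq⟩ := hf
    obtain ⟨g, hg1, hg2, -⟩ := (h.hasEdge_iff hqp.symm).1 ⟨f, h1, hq, rfl⟩
    refine ⟨g, ?_, q, hqp, hq, h1, hg2, hg1⟩
    simp only [Finset.mem_filter, mem_atCov]
    refine ⟨⟨hg1, ?_⟩, q, hqp, hg2⟩
    obtain ⟨c, hc, rfl⟩ := (covers_sub h1.mem_img hq.mem_img).pos_parallel h1
      (sub_ne_zero.2 hqp) hu h2
    exact (covers_sub hg1.mem_img hg2.mem_img).smul hc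
  · rintro g - f₁ ⟨-, x, hx, k1, k2, k3, k4⟩ f₂ ⟨-, y, hy, m1, m2, m3, m4⟩
    obtain rfl : y = x := (k4.eq_or_eq hx.symm k3 m3).resolve_left hy
    exact N.double hy k1 k2 m1 m2

open Classical in
/-- The number of unbounded edges at `p` in direction `u` is determined. -/
lemma Similar.card_ends_eq (h : Similar N N') {p u : ℝ × ℝ} (hp : p ∈ N.verts) (hu : u ≠ 0) :
    ((N.atCov p u).filter fun e => ¬ ∃ q, q ≠ p ∧ N.At q e).card =
      ((N'.atCov p u).filter fun e => ¬ ∃ q, q ≠ p ∧ N'.At q e).card := by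
  have h1 := h.card_bounded_le p hu
  have h2 := h.symm.card_bounded_le p hu
  have h3 := h.card_atCov_eq hp hu (h.passLine_iff hp hu)
  rw [← Finset.card_filter_add_card_filter_not (s := N.atCov p u) fun e => ∃ q, q ≠ p ∧ N.At q e,
    ← Finset.card_filter_add_card_filter_not (s := N'.atCov p u)
      fun e => ∃ q, q ≠ p ∧ N'.At q e] at h3
  omega

end Net
end TropicalDescendant

/-! ### The net of a simple tropical curve -/

namespace TropicalDescendant

/-- Take a member of T farthest from a root chosen in T: its neighbours in T are closer to the root,
and in a tree only one neighbour is. -/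
lemma exists_leaf_of_isTree {V : Type*} [Finite V] {G : SimpleGraph V} (hG : G.IsTree)
    {T : Set V} (hT : T.Nonempty) :
    ∃ v ∈ T, ∀ w ∈ T, ∀ x ∈ T, G.Adj v w → G.Adj v x → w = x := by
  classical
  obtain ⟨r, hr⟩ := hT
  obtain ⟨v, hv, hmax⟩ := Set.exists_max_image T (G.dist r) T.toFinite ⟨r, hr⟩
  obtain ⟨P, hP, -⟩ := hG.connected.exists_path_of_dist r v
  have key : ∀ w ∈ T, G.Adj v w → w = P.penultimate := by
    intro w hw hvw
    obtain ⟨Q, hQ, hlen⟩ := hG.connected.exists_path_of_dist r w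
    have hlt : G.dist r w < G.dist r v :=
      lt_of_le_of_ne (hmax w hw) (hG.dist_ne_of_adj r hvw).symm
    have hvQ : v ∉ Q.support := by
      intro hmem
      have h1 := SimpleGraph.dist_le (Q.takeUntil v hmem)
      have h2 := Q.length_takeUntil_le_length hmem
      omega
    exact hG.isAcyclic.eq_penultimate_of_adj_end hP hvw
      (hG.isAcyclic.mem_support_of_ne_mem_support_of_adj_of_isPath hP hQ hvw hvQ)
  exact ⟨v, hv, fun w hw x hx h1 h2 => (key w hw h1).trans (key x hx h2).symm⟩

lemma toPlane_eq_zero {u : ℤ × ℤ} : toPlane u = 0 ↔ u = 0 := by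
  simp [toPlane, Prod.ext_iff]

lemma toPlane_neg (u : ℤ × ℤ) : toPlane (-u) = -toPlane u := by
  simp [toPlane]

lemma toPlane_add (u v : ℤ × ℤ) : toPlane (u + v) = toPlane u + toPlane v := by
  simp [toPlane]

/-- An integral vector is determined by its ray and its integral length. -/
lemma eq_of_parallel_of_gcd_eq {a b : ℤ × ℤ} (hg : Int.gcd a.1 a.2 = Int.gcd b.1 b.2) {s t : ℝ}
    (hs : 0 < s) (ht : 0 < t) (h : s • toPlane a = t • toPlane b) : a = b := by
  have key : ∀ a₁ a₂ b₁ b₂ : ℤ, Int.gcd a₁ a₂ = Int.gcd b₁ b₂ → s * a₁ = t * b₁ → s * a₂ = t * b₂ →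
      a₁ ≠ 0 → a₁ = b₁ ∧ a₂ = b₂ := by
    intro a₁ a₂ b₁ b₂ hg h1 h2 ha
    have hcross : a₁ * b₂ = a₂ * b₁ := by
      have : (s * t) * ((a₁ : ℝ) * b₂) = (s * t) * (a₂ * b₁) := by
        linear_combination (t * b₂) * h1 - (t * b₁) * h2
      exact_mod_cast mul_left_cancel₀ (by positivity) this
    have hgpos : 0 < Int.gcd a₁ a₂ := Int.gcd_pos_of_ne_zero_left _ ha
    have habs : a₁.natAbs = b₁.natAbs := by
      have e1 : Int.gcd (a₁ * b₁) (a₁ * b₂) = a₁.natAbs * Int.gcd b₁ b₂ := Int.gcd_mul_left ..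
      have e2 : Int.gcd (b₁ * a₁) (b₁ * a₂) = b₁.natAbs * Int.gcd a₁ a₂ := Int.gcd_mul_left ..
      rw [hcross, mul_comm a₁ b₁, mul_comm a₂ b₁, e2, ← hg] at e1
      exact (Nat.eq_of_mul_eq_mul_right hgpos e1).symm
    have hb : a₁ = b₁ := by
      rcases Int.natAbs_eq_natAbs_iff.1 habs with h | h
      · exact h
      · exfalso
        have : (s + t) * (a₁ : ℝ) = 0 := by
          rw [h] at h1 ⊢
          push_cast at h1 ⊢
          linarith
        rcases mul_eq_zero.1 this with h | h
        · linarith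
        · exact ha (by exact_mod_cast h)
    subst hb
    have hst : s = t := mul_right_cancel₀ (by exact_mod_cast ha) h1
    subst hst
    exact ⟨rfl, by exact_mod_cast mul_left_cancel₀ hs.ne' h2⟩
  obtain ⟨a₁, a₂⟩ := a
  obtain ⟨b₁, b₂⟩ := b
  simp only [toPlane, Prod.smul_mk, smul_eq_mul, Prod.mk.injEq] at h hg ⊢
  by_cases ha : a₁ = 0
  · by_cases ha' : a₂ = 0
    · subst ha ha'
      simpa [ht.ne', eq_comm] using h
    · rw [Int.gcd_comm, Int.gcd_comm b₁] at hg
      exact (key a₂ a₁ b₂ b₁ hg h.2 h.1 ha').symm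
  · exact key a₁ a₂ b₁ b₂ hg h.1 h.2 ha

namespace TropicalCurve

variable {n d : ℕ} {C : TropicalCurve n d}

lemma dir_ne_zero (hC : C.IsSimple) {v w : C.V} (h : C.graph.Adj v w) : C.dir v w ≠ 0 := by
  intro h0
  have := C.pos_eq v w h
  rw [h0, toPlane_eq_zero.2 rfl, smul_zero, add_zero] at this
  exact h.ne (hC.injective_vertices this).symm

lemma endDir_ne_zero (b : C.End) : C.endDir b ≠ 0 := by
  rcases C.endDir_mem b with h | h | h <;> simp [h]

lemma edgeImage_inl {v w : C.V} (h : C.graph.Adj v w) :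
    C.edgeImage (Sum.inl ⟨s(v, w), h⟩) = segment ℝ (C.pos v) (C.pos w) := by
  have hl := C.len_pos v w h
  have key : ∀ v w, C.graph.Adj v w → ∀ p t, 0 ≤ t → t ≤ C.len s(v, w) →
      p = C.pos v + t • toPlane (C.dir v w) → p ∈ segment ℝ (C.pos v) (C.pos w) := by
    intro v w h p t h0 h1 hp
    have hl := C.len_pos v w h
    rw [segment_eq_image']
    refine ⟨t / C.len s(v, w), ⟨by positivity, (div_le_one hl).2 h1⟩, ?_⟩
    rw [hp, C.pos_eq v w h, add_sub_cancel_left]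
    simp only [smul_smul]
    rw [div_mul_cancel₀ _ hl.ne']
  ext p
  constructor
  · rintro ⟨a, b, hab, t, h0, h1, hp⟩
    rcases Sym2.eq_iff.1 hab with ⟨rfl, rfl⟩ | ⟨rfl, rfl⟩
    · exact key a b h p t h0 h1 hp
    · rw [segment_symm]
      exact key a b h.symm p t h0 (by rwa [Sym2.eq_swap]) hp
  · rw [segment_eq_image']
    rintro ⟨t, ⟨h0, h1⟩, rfl⟩
    refine ⟨v, w, rfl, t * C.len s(v, w), by positivity, mul_le_of_le_one_left hl.le h1, ?_⟩
    simp only [C.pos_eq v w h, add_sub_cancel_left, smul_smul]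

lemma mem_openEdgeImage {p : ℝ × ℝ} {e : C.Edge} (hp : p ∈ C.edgeImage e)
    (hn : ∀ v, C.Incident v e → C.pos v ≠ p) : p ∈ C.openEdgeImage e := by
  rcases e with ⟨e, he⟩ | b
  · obtain ⟨v, w, rfl, t, h0, h1, rfl⟩ := hp
    refine ⟨v, w, rfl, t, lt_of_le_of_ne h0 ?_, lt_of_le_of_ne h1 ?_, rfl⟩
    · rintro rfl
      exact hn v (Sym2.mem_mk_left v w) (by simp)
    · rintro rfl
      exact hn w (Sym2.mem_mk_right v w) (C.pos_eq v w he)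
  · obtain ⟨t, h0, rfl⟩ := hp
    refine ⟨t, lt_of_le_of_ne h0 ?_, rfl⟩
    rintro rfl
    exact hn _ rfl (by simp)

lemma eq_of_incident {v w : C.V} {e : C.Edge} (hvw : v ≠ w) (hv : C.Incident v e)
    (hw : C.Incident w e) : ∃ h : C.graph.Adj v w, e = Sum.inl ⟨s(v, w), h⟩ := by
  rcases e with ⟨e, he⟩ | b
  · obtain rfl := (Sym2.mem_and_mem_iff hvw).1 ⟨hv, hw⟩
    exact ⟨he, rfl⟩
  · exact absurd (hv.symm.trans hw) hvw

/-- The net of segments and rays of a simple curve. -/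
noncomputable def net (C : TropicalCurve n d) (hC : C.IsSimple) : Net where
  E := C.Edge
  fintypeE := Fintype.ofFinite _
  verts := Set.range C.pos
  finite_verts := Set.finite_range _
  img := C.edgeImage
  At p e := ∃ v, C.pos v = p ∧ C.Incident v e
  wt := C.weight
  at_mem := fun ⟨v, hv, _⟩ => ⟨v, hv⟩
  shape := by
    rintro (⟨e, he⟩ | b)
    · induction e using Sym2.ind with
      | _ v w =>
        left
        refine ⟨C.pos v, C.pos w, fun h => he.ne (hC.injective_vertices h), fun x => ?_,
          edgeImage_inl he⟩
        constructor
        · rintro ⟨y, rfl, hy⟩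
          rcases Sym2.mem_iff.1 hy with rfl | rfl
          exacts [Or.inl rfl, Or.inr rfl]
        · rintro (rfl | rfl)
          exacts [⟨v, rfl, Sym2.mem_mk_left v w⟩, ⟨w, rfl, Sym2.mem_mk_right v w⟩]
    · right
      refine ⟨C.pos (C.endAt b), toPlane (C.endDir b),
        fun h => endDir_ne_zero b (toPlane_eq_zero.1 h), fun x => ?_, rfl⟩
      constructor
      · rintro ⟨y, rfl, hy⟩
        exact congrArg C.pos (Eq.symm hy)
      · rintro rfl
        exact ⟨_, rfl, rfl⟩
  vertex_on_edge := by
    rintro _ e ⟨v, rfl⟩ h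
    obtain ⟨e', h1, h2⟩ := hC.vertex_on_edge v e h
    exact ⟨e', ⟨v, rfl, h1⟩, h2⟩
  overlap := by
    intro e e' hne h
    obtain ⟨v, h1, h2⟩ := hC.overlap_shares_vertex e e' hne h
    exact ⟨C.pos v, ⟨v, rfl, h1⟩, ⟨v, rfl, h2⟩⟩
  double := by
    rintro _ _ e e' hpq ⟨v, rfl, h1⟩ ⟨w, rfl, h2⟩ ⟨v', hv', h3⟩ ⟨w', hw', h4⟩
    obtain rfl := hC.injective_vertices hv'
    obtain rfl := hC.injective_vertices hw'
    have hne := fun h => hpq (congrArg C.pos h)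
    obtain ⟨_, rfl⟩ := eq_of_incident hne h1 h2
    obtain ⟨_, rfl⟩ := eq_of_incident hne h3 h4
    rfl
  leaf := by
    intro T hT ⟨p, hp⟩
    obtain ⟨v₀, rfl⟩ := hT hp
    obtain ⟨v, hv, hvv⟩ := exists_leaf_of_isTree C.isTree (T := C.pos ⁻¹' T) ⟨v₀, hp⟩
    have key : ∀ q ∈ T, q ≠ C.pos v → (∃ e, (∃ x, C.pos x = C.pos v ∧ C.Incident x e) ∧
        ∃ x, C.pos x = q ∧ C.Incident x e) → ∃ w, C.pos w = q ∧ C.graph.Adj v w := by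
      rintro _ hq hqv ⟨e, ⟨x, hx, h1⟩, ⟨w, rfl, h2⟩⟩
      obtain rfl := hC.injective_vertices hx
      obtain ⟨h, -⟩ := eq_of_incident (fun h => hqv (congrArg C.pos h.symm)) h1 h2
      exact ⟨w, rfl, h⟩
    refine ⟨C.pos v, hv, fun q hq r hr hqv hrv h1 h2 => ?_⟩
    obtain ⟨w, rfl, h3⟩ := key q hq hqv h1
    obtain ⟨x, rfl, h4⟩ := key r hr hrv h2
    rw [hvv w hq x hr h3 h4]

open Filter Topology in
-- Edge images are closed and convex, so close to p on the ray an edge is present exactly if it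
-- contains the germ.
lemma eventually_weightsAt (hC : C.IsSimple) (p u : ℝ × ℝ) :
    ∀ᶠ t : ℝ in 𝓝[>] 0,
      C.weightsAt (p + t • u) = ((C.net hC).cov p u).val.map (C.net hC).wt := by
  classical
  have h : ∀ᶠ t : ℝ in 𝓝[>] 0, ∀ e : C.Edge,
      p + t • u ∈ C.edgeImage e ↔ (C.net hC).Covers e p u := by
    rw [eventually_all]
    intro e
    by_cases hp : p ∈ (C.net hC).img e
    · by_cases hc : (C.net hC).Covers e p u
      · obtain ⟨ε, hε, h2⟩ := hc.2
        filter_upwards [Ioo_mem_nhdsGT hε] with t ht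
        exact iff_of_true (Net.mem_img_of_mem hp h2 ht.1.le ht.2.le) hc
      · filter_upwards [self_mem_nhdsWithin] with t ht
        exact iff_of_false (fun h => hc ⟨hp, t, ht, h⟩) hc
    · have hopen : IsOpen ((C.net hC).img e)ᶜ := ((C.net hC).isClosed_img e).isOpen_compl
      have hcont : Tendsto (fun t : ℝ => p + t • u) (𝓝[>] 0) (𝓝 p) := by
        have : Tendsto (fun t : ℝ => p + t • u) (𝓝 0) (𝓝 (p + (0 : ℝ) • u)) :=
          Continuous.tendsto (by fun_prop) 0
        rw [zero_smul, add_zero] at this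
        exact this.mono_left nhdsWithin_le_nhds
      filter_upwards [hcont (hopen.mem_nhds hp)] with t ht
      exact iff_of_false ht fun h => hp h.1
  filter_upwards [h] with t ht
  refine congrArg (fun s : Finset C.Edge => s.val.map C.weight) (Finset.ext fun e => ?_)
  rw [Finset.mem_filter, ht]
  exact ⟨fun h => Net.mem_cov.2 h.2, fun h => ⟨Finset.mem_univ _, Net.mem_cov.1 h⟩⟩

end TropicalCurve
end TropicalDescendant

/-! ### Labels along germs, flags at a vertex, and rigidity -/

namespace TropicalDescendant
namespace TropicalCurve

variable {n d : ℕ} {C C' : TropicalCurve n d}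

open Filter Topology in
-- The labels agree off a finite set, which misses all points of the ray near p.
lemma net_label_eq (hC : C.IsSimple) (hC' : C'.IsSimple)
    (hL : C.labelledImage = C'.labelledImage) {p u : ℝ × ℝ} (hu : u ≠ 0) :
    ((C.net hC).cov p u).val.map (C.net hC).wt =
      ((C'.net hC').cov p u).val.map (C'.net hC').wt := by
  have h1 : C.weightsAt =ᶠ[cofinite] C'.weightsAt :=
    Filter.Germ.coe_eq.1 (congrArg LabelledImage.label hL)
  have hinj : Function.Injective fun t : ℝ => p + t • u := fun s t h =>
    smul_left_injective ℝ hu (add_left_cancel h)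
  have h2 : ∀ᶠ t : ℝ in 𝓝[>] 0, C.weightsAt (p + t • u) = C'.weightsAt (p + t • u) := by
    have := hinj.tendsto_cofinite.eventually h1
    exact this.filter_mono
      ((nhdsWithin_mono _ fun x hx => ne_of_gt hx).trans (nhdsNE_le_cofinite 0))
  obtain ⟨t, h3, h4, h5⟩ :=
    (h2.and ((eventually_weightsAt hC p u).and (eventually_weightsAt hC' p u))).exists
  rw [← h4, ← h5, h3]

/-- The bounded edges and unmarked ends at `v`, as seen from `v`. -/
abbrev Flag (C : TropicalCurve n d) (v : C.V) : Type :=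
  {w // C.graph.Adj v w} ⊕ {b // C.endAt b = v}

/-- The direction of a flag, pointing away from its vertex. -/
def flagDir {v : C.V} : C.Flag v → ℤ × ℤ
  | Sum.inl w => C.dir v w
  | Sum.inr b => C.endDir b

/-- The edge of a flag. -/
def flagEdge {v : C.V} : C.Flag v → C.Edge
  | Sum.inl w => Sum.inl ⟨s(v, w), w.2⟩
  | Sum.inr b => Sum.inr b

lemma flagEdge_injective (v : C.V) : Function.Injective (flagEdge (C := C) (v := v)) := by
  rintro (⟨w, hw⟩ | ⟨b, hb⟩) (⟨w', hw'⟩ | ⟨b', hb'⟩) h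
  · obtain rfl := Sym2.congr_right.1 (congrArg Subtype.val (Sum.inl.inj h))
    rfl
  · simp [flagEdge] at h
  · simp [flagEdge] at h
  · simp only [flagEdge, Sum.inr.injEq] at h
    subst h; rfl

lemma incident_flagEdge {v : C.V} (f : C.Flag v) : C.Incident v (flagEdge f) := by
  rcases f with ⟨w, hw⟩ | ⟨b, hb⟩
  · exact Sym2.mem_mk_left v w
  · exact hb

lemma exists_flag {v : C.V} {e : C.Edge} (h : C.Incident v e) : ∃ f : C.Flag v, flagEdge f = e := by
  rcases e with ⟨e, he⟩ | b
  · induction e using Sym2.ind with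
    | _ x y =>
      rcases Sym2.mem_iff.1 h with rfl | rfl
      · exact ⟨Sum.inl ⟨y, he⟩, rfl⟩
      · exact ⟨Sum.inl ⟨x, he.symm⟩, by simp [flagEdge, Sym2.eq_swap]⟩
  · exact ⟨Sum.inr ⟨b, h⟩, rfl⟩

lemma flagDir_ne_zero (hC : C.IsSimple) {v : C.V} (f : C.Flag v) : flagDir f ≠ 0 := by
  rcases f with ⟨w, hw⟩ | ⟨b, hb⟩
  · exact dir_ne_zero hC hw
  · exact endDir_ne_zero b

lemma finsum_flagDir (v : C.V) : ∑ᶠ f : C.Flag v, flagDir f = 0 := by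
  classical
  have := C.balanced v
  rw [← finsum_set_coe_eq_finsum_mem, ← finsum_set_coe_eq_finsum_mem] at this
  rw [finsum_eq_sum_of_fintype, Fintype.sum_sum_type, ← finsum_eq_sum_of_fintype,
    ← finsum_eq_sum_of_fintype]
  exact this

lemma card_flag (v : C.V) : Nat.card (C.Flag v) =
    {w | C.graph.Adj v w}.ncard + {b | C.endAt b = v}.ncard := by
  rw [Nat.card_sum]; rfl

lemma covers_flagEdge (hC : C.IsSimple) {v : C.V} (f : C.Flag v) :
    (C.net hC).Covers (flagEdge f) (C.pos v) (toPlane (flagDir f)) := by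
  rcases f with ⟨w, hw⟩ | ⟨b, rfl⟩
  · have h1 : C.edgeImage (flagEdge (Sum.inl ⟨w, hw⟩)) = _ := edgeImage_inl hw
    refine ⟨?_, C.len s(v, w), C.len_pos v w hw, ?_⟩
    · change C.pos v ∈ C.edgeImage (flagEdge (Sum.inl ⟨w, hw⟩))
      rw [h1]; exact left_mem_segment _ _ _
    · change C.pos v + C.len s(v, w) • toPlane (C.dir v w) ∈
        C.edgeImage (flagEdge (Sum.inl ⟨w, hw⟩))
      rw [h1]
      have := C.pos_eq v w hw
      rw [← this]
      exact right_mem_segment _ _ _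
  · exact ⟨⟨0, le_rfl, by simp⟩, 1, one_pos, ⟨1, zero_le_one, rfl⟩⟩

lemma card_at_pos (hC : C.IsSimple) (v : C.V) :
    Nat.card {e // (C.net hC).At (C.pos v) e} = Nat.card (C.Flag v) := by
  refine (Nat.card_congr (Equiv.ofBijective (fun f : C.Flag v =>
    (⟨flagEdge f, v, rfl, incident_flagEdge f⟩ : {e // (C.net hC).At (C.pos v) e})) ⟨?_, ?_⟩)).symm
  · intro f g h
    exact flagEdge_injective v (congrArg Subtype.val h)
  · rintro ⟨e, w, hw, he⟩
    obtain rfl := hC.injective_vertices hw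
    obtain ⟨f, hf⟩ := exists_flag he
    exact ⟨f, Subtype.ext hf⟩

open Filter Topology in
/-- At an unmarked vertex of a rigid curve, the bounded edges do not lie on one line. -/
lemma IsRigid.not_parallel (hR : C.IsRigid) (hC : C.IsSimple) {v : C.V} (hv : ∀ i, C.markAt i ≠ v)
    {D : ℝ × ℝ} (hD : D ≠ 0) (hpar : ∀ w, C.graph.Adj v w → ∃ c : ℝ, toPlane (C.dir v w) = c • D) :
    False := by
  classical
  let dot : ℝ × ℝ → ℝ × ℝ → ℝ := fun x y => x.1 * y.1 + x.2 * y.2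
  -- The vertex v slides by ε along D while everything else stays. New lengths are read off by
  -- projecting differences of positions to the edge directions; they are symmetric in the two ends,
  -- and positive for small ε.
  let pos' : ℝ → C.V → ℝ × ℝ := fun ε => Function.update C.pos v (C.pos v + ε • D)
  let g : ℝ → C.V → C.V → ℝ := fun ε a b =>
    dot (pos' ε b - pos' ε a) (toPlane (C.dir a b)) / dot (toPlane (C.dir a b)) (toPlane (C.dir a b))
  have hg : ∀ ε a b, g ε a b = g ε b a := by
    intro ε a b
    simp only [g, dot, C.dir_symm a b, toPlane_neg, Prod.fst_neg, Prod.snd_neg, Prod.fst_sub,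
      Prod.snd_sub]
    congr 1 <;> ring
  let len' : ℝ → Sym2 C.V → ℝ := fun ε => Sym2.lift ⟨g ε, hg ε⟩
  have hdot : ∀ a b, C.graph.Adj a b → 0 < dot (toPlane (C.dir a b)) (toPlane (C.dir a b)) := by
    intro a b hab
    have := fun h => dir_ne_zero hC hab (toPlane_eq_zero.1 h)
    simp only [dot]
    rcases eq_or_ne (toPlane (C.dir a b)).1 0 with h1 | h1
    · have h2 : (toPlane (C.dir a b)).2 ≠ 0 := fun h2 => this (Prod.ext h1 h2)
      have := mul_self_pos.2 h2
      nlinarith [mul_self_nonneg (toPlane (C.dir a b)).1]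
    · have := mul_self_pos.2 h1
      nlinarith [mul_self_nonneg (toPlane (C.dir a b)).2]
  -- whenever the difference of the new positions is parallel to the edge, the edge fits
  have hfit : ∀ ε a b, C.graph.Adj a b → (∃ c : ℝ, pos' ε b - pos' ε a = c • toPlane (C.dir a b)) →
      pos' ε b = pos' ε a + len' ε s(a, b) • toPlane (C.dir a b) := by
    rintro ε a b hab ⟨c, hc⟩
    have : g ε a b = c := by
      have h1 : dot (c • toPlane (C.dir a b)) (toPlane (C.dir a b)) =
          c * dot (toPlane (C.dir a b)) (toPlane (C.dir a b)) := by
        simp only [dot, Prod.smul_fst, Prod.smul_snd, smul_eq_mul]; ring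
      simp only [g]
      rw [hc, h1, mul_div_cancel_right₀ _ (hdot a b hab).ne']
    change _ = _ + g ε a b • _
    rw [this, ← hc, add_sub_cancel]
  have hdiff : ∀ w, C.graph.Adj v w → ∃ c : ℝ, D = c • toPlane (C.dir v w) := by
    intro w hw
    obtain ⟨c, hc⟩ := hpar w hw
    have hc0 : c ≠ 0 := by
      rintro rfl
      rw [zero_smul, toPlane_eq_zero] at hc
      exact dir_ne_zero hC hw hc
    exact ⟨c⁻¹, by rw [hc, smul_smul, inv_mul_cancel₀ hc0, one_smul]⟩
  have hpos_eq : ∀ ε a b, C.graph.Adj a b →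
      pos' ε b = pos' ε a + len' ε s(a, b) • toPlane (C.dir a b) := by
    intro ε a b hab
    refine hfit ε a b hab ?_
    have h0 := C.pos_eq a b hab
    by_cases ha : a = v
    · subst ha
      obtain ⟨c, hc⟩ := hdiff b hab
      refine ⟨C.len s(a, b) - ε * c, ?_⟩
      simp only [pos', Function.update_self, Function.update_of_ne hab.ne']
      rw [h0]
      nth_rw 1 [hc]
      module
    · by_cases hb : b = v
      · subst hb
        obtain ⟨c, hc⟩ := hdiff a hab.symm
        rw [C.dir_symm a b, toPlane_neg] at hc
        refine ⟨C.len s(a, b) - ε * c, ?_⟩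
        simp only [pos', Function.update_self, Function.update_of_ne ha]
        rw [h0]
        nth_rw 1 [hc]
        module
      · refine ⟨C.len s(a, b), ?_⟩
        simp only [pos', Function.update_of_ne ha, Function.update_of_ne hb]
        rw [h0, add_sub_cancel_left]
  have hzero : pos' 0 = C.pos := by simp [pos']
  have hlen0 : ∀ a b, C.graph.Adj a b → g 0 a b = C.len s(a, b) := by
    intro a b hab
    have h1 := hpos_eq 0 a b hab
    rw [hzero, C.pos_eq a b hab] at h1
    have h2 := add_left_cancel h1
    exact (smul_left_injective ℝ (fun h => dir_ne_zero hC hab (toPlane_eq_zero.1 h)) h2).symm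
  have hcont : ∀ a b, Continuous fun ε => g ε a b := by
    intro a b
    have hp : ∀ x, Continuous fun ε => pos' ε x := by
      intro x
      by_cases hx : x = v
      · subst hx
        simp only [pos', Function.update_self]
        fun_prop
      · simp only [pos', Function.update_of_ne hx]
        fun_prop
    have := hp a
    have := hp b
    simp only [g, dot]
    fun_prop
  have hev : ∀ᶠ ε in 𝓝 (0 : ℝ), ∀ a b, C.graph.Adj a b → 0 < g ε a b := by
    rw [eventually_all]; intro a
    rw [eventually_all]; intro b
    by_cases hab : C.graph.Adj a b
    · have : Tendsto (fun ε => g ε a b) (𝓝 0) (𝓝 (g 0 a b)) := (hcont a b).tendsto 0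
      filter_upwards [this.eventually (lt_mem_nhds (hlen0 a b hab ▸ C.len_pos a b hab))]
        with ε hε _ using hε
    · exact Eventually.of_forall fun ε h => absurd h hab
  obtain ⟨ε, hε, hε0⟩ := ((hev.filter_mono nhdsWithin_le_nhds).and
    (self_mem_nhdsWithin : {0}ᶜ ∈ 𝓝[≠] (0 : ℝ))).exists
  obtain ⟨h1, -⟩ := hR (len' ε) (pos' ε) (fun a b hab => hε a b hab) (hpos_eq ε) fun i => by
    simp only [pos', Function.update_of_ne (hv i)]; rfl
  have h2 := congrFun h1 v
  simp only [pos', Function.update_self, add_eq_left, smul_eq_zero] at h2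
  exact h2.elim hε0 hD

end TropicalCurve
end TropicalDescendant

/-! ### Recovering vertices, valences and the isomorphism from the labelled image -/

namespace TropicalDescendant
namespace TropicalCurve

variable {n d : ℕ} {C C' : TropicalCurve n d}

/-- The position of an unmarked vertex is seen in the labelled image: three edges with pairwise
independent directions start there. -/
lemma exists_three_directions (hC : C.IsSimple) {r : Fin n → ℕ}
    (hI : C.InteriorOfFacet r) (hR : C.IsRigid) {v : C.V} (hv : ∀ i, C.markAt i ≠ v) :
    ∃ u : Fin 3 → ℝ × ℝ, (∀ i, u i ≠ 0) ∧ (∀ i j, i ≠ j → ∀ c : ℝ, u i ≠ c • u j) ∧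
      ∀ i, ((C.net hC).cov (C.pos v) (u i)).Nonempty := by
  classical
  have hval := hI v
  have h1 : {i | C.markAt i = v} = ∅ := Set.eq_empty_iff_forall_notMem.2 hv
  have h2 : C.psiSum r v = 0 := by
    unfold AbstractCurve.psiSum
    exact Finset.sum_eq_zero fun i hi => absurd (Finset.mem_filter.1 hi).2 (hv i)
  rw [AbstractCurve.valence, h1, h2, Set.ncard_empty, add_zero, add_zero, ← card_flag,
    Nat.card_eq_fintype_card] at hval
  let f : Fin 3 ≃ C.Flag v := (Fintype.equivFinOfCardEq hval).symm
  let u : Fin 3 → ℝ × ℝ := fun i => toPlane (flagDir (f i))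
  have hu0 : ∀ i, u i ≠ 0 := fun i h => flagDir_ne_zero hC (f i) (toPlane_eq_zero.1 h)
  have hsum : u 0 + u 1 + u 2 = 0 := by
    have h3 := finsum_flagDir (C := C) v
    rw [finsum_eq_sum_of_fintype, ← f.sum_comp, Fin.sum_univ_three] at h3
    have := congrArg toPlane h3
    rwa [toPlane_add, toPlane_add, toPlane_eq_zero.2 rfl] at this
  refine ⟨u, hu0, fun i j hij c hc => ?_, fun i => ⟨flagEdge (f i), ?_⟩⟩
  · refine hR.not_parallel hC hv (hu0 j) fun w hw => ?_
    -- Two parallel directions force the third to be parallel by balancing; then v could slide along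
    -- the line.
    have hall : ∀ k, ∃ c : ℝ, u k = c • u j := by
      intro k
      by_cases hkj : k = j
      · exact ⟨1, by rw [hkj, one_smul]⟩
      by_cases hki : k = i
      · exact ⟨c, by rw [hki, hc]⟩
      have : u i + u j + u k = 0 := by
        rw [← hsum]
        fin_cases i <;> fin_cases j <;> fin_cases k <;> simp at hij hkj hki ⊢ <;> abel
      refine ⟨-(c + 1), ?_⟩
      rw [eq_neg_of_add_eq_zero_right this, hc]
      module
    have := hall (f.symm (Sum.inl ⟨w, hw⟩))
    simp only [u, Equiv.apply_symm_apply] at this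
    exact this
  · exact Net.mem_cov.2 (covers_flagEdge hC (f i))

/-- Away from the vertices, three edges through p with different slopes contradict the last
condition of simplicity. -/
lemma mem_verts_of_three_directions (hC : C.IsSimple) {p : ℝ × ℝ} (u : Fin 3 → ℝ × ℝ)
    (hu0 : ∀ i, u i ≠ 0) (hu : ∀ i j, i ≠ j → ∀ c : ℝ, u i ≠ c • u j)
    (hcov : ∀ i, ((C.net hC).cov p (u i)).Nonempty) : p ∈ Set.range C.pos := by
  by_contra hp
  choose e he using hcov
  replace he : ∀ i, (C.net hC).Covers (e i) p (u i) := fun i => Net.mem_cov.1 (he i)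
  have hopen : ∀ i, e i ∈ {e | p ∈ C.openEdgeImage e} := fun i =>
    mem_openEdgeImage (he i).1 fun v _ hv => hp ⟨v, hv⟩
  have hspan : ∀ i, u i ∈ vectorSpan ℝ (C.edgeImage (e i)) := by
    intro i
    obtain ⟨h1, ε, hε, h2⟩ := he i
    have h3 := vsub_mem_vectorSpan ℝ (s := C.edgeImage (e i)) h2 h1
    rw [vsub_eq_sub, add_sub_cancel_left] at h3
    have h4 := Submodule.smul_mem _ ε⁻¹ h3
    rwa [smul_smul, inv_mul_cancel₀ hε.ne', one_smul] at h4
  have hinj : Function.Injective fun i => vectorSpan ℝ (C.edgeImage (e i)) := by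
    intro i j hij
    by_contra hne
    obtain ⟨D, hD, hl⟩ := (C.net hC).exists_line (e j)
    have hle : vectorSpan ℝ (C.edgeImage (e j)) ≤ Submodule.span ℝ {D} := by
      rw [vectorSpan_def, Submodule.span_le]
      rintro _ ⟨x, hx, y, hy, rfl⟩
      obtain ⟨c, hc⟩ := hl y hy x hx
      exact Submodule.mem_span_singleton.2 ⟨c, hc.symm⟩
    have hi : u i ∈ vectorSpan ℝ (C.edgeImage (e j)) := by
      have := hspan i
      rwa [show vectorSpan ℝ (C.edgeImage (e i)) = _ from hij] at this
    obtain ⟨a, ha⟩ := Submodule.mem_span_singleton.1 (hle hi)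
    obtain ⟨b, hb⟩ := Submodule.mem_span_singleton.1 (hle (hspan j))
    have hb0 : b ≠ 0 := by
      rintro rfl
      exact hu0 j (by rw [← hb, zero_smul])
    exact hu i j hne (a * b⁻¹)
      (by rw [← ha, ← hb, smul_smul, mul_assoc, inv_mul_cancel₀ hb0, mul_one])
  have hinj' : Function.Injective e := fun i j h => hinj (by simp only [h])
  have key : ∀ {α : Type} (s : Set α) (f : Fin 3 → α), s.Finite → Function.Injective f →
      (∀ i, f i ∈ s) → 3 ≤ s.ncard := by
    intro α s f hs hf hm
    have h1 := Set.ncard_le_ncard (Set.range_subset_iff.2 hm) hs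
    rwa [Set.ncard_range_of_injective hf, Nat.card_eq_fintype_card, Fintype.card_fin] at h1
  have h1 := key _ e (Set.toFinite _) hinj' hopen
  have h2 := key _ _ (Set.Finite.image (fun e => vectorSpan ℝ (C.edgeImage e)) (Set.toFinite _))
    hinj fun i => ⟨e i, hopen i, rfl⟩
  have h3 := hC.slopes p h1
  omega

lemma range_pos_subset (hC : C.IsSimple) (hC' : C'.IsSimple) {r : Fin n → ℕ}
    (hI : C.InteriorOfFacet r) (hR : C.IsRigid) (hL : C.labelledImage = C'.labelledImage)
    (hev : ∀ i, C.ev i = C'.ev i) : Set.range C.pos ⊆ Set.range C'.pos := by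
  rintro _ ⟨v, rfl⟩
  by_cases hv : ∃ i, C.markAt i = v
  · obtain ⟨i, rfl⟩ := hv
    exact ⟨C'.markAt i, (hev i).symm⟩
  · push Not at hv
    obtain ⟨u, h0, h1, h2⟩ := exists_three_directions hC hI hR hv
    refine mem_verts_of_three_directions hC' u h0 h1 fun i => ?_
    have := congrArg Multiset.card (net_label_eq hC hC' hL (p := C.pos v) (h0 i))
    rw [Multiset.card_map, Multiset.card_map, Finset.card_val, Finset.card_val] at this
    rw [← Finset.card_pos, ← this, Finset.card_pos]
    exact h2 i

/-- The number of edges at a vertex is determined by its position and the marked points. -/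
lemma card_at_eq (hC : C.IsSimple) {r : Fin n → ℕ} (hI : C.InteriorOfFacet r) (v : C.V) :
    Nat.card {e // (C.net hC).At (C.pos v) e} + {i | C.ev i = C.pos v}.ncard =
      3 + ∑ i ∈ {i | C.ev i = C.pos v}.toFinite.toFinset, r i := by
  classical
  have h := hI v
  have hiff : ∀ i, C.ev i = C.pos v ↔ C.markAt i = v := fun i => hC.injective_vertices.eq_iff
  rw [card_at_pos, card_flag]
  simp only [hiff]
  rw [AbstractCurve.valence, AbstractCurve.psiSum] at h
  rw [h]
  congr 2
  ext i
  simp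

lemma net_similar (hC : C.IsSimple) (hC' : C'.IsSimple) {r : Fin n → ℕ}
    (hI : C.InteriorOfFacet r) (hI' : C'.InteriorOfFacet r) (hR : C.IsRigid) (hR' : C'.IsRigid)
    (hL : C.labelledImage = C'.labelledImage) (hev : ∀ i, C.ev i = C'.ev i) :
    Net.Similar (C.net hC) (C'.net hC') := by
  have hrange : Set.range C.pos = Set.range C'.pos :=
    (range_pos_subset hC hC' hI hR hL hev).antisymm
      (range_pos_subset hC' hC hI' hR' hL.symm fun i => (hev i).symm)
  refine ⟨hrange, fun p u hu => net_label_eq hC hC' hL hu, fun p => ?_⟩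
  by_cases hp : p ∈ Set.range C.pos
  · obtain ⟨v', hv'⟩ := hrange ▸ hp
    obtain ⟨v, rfl⟩ := hp
    have h1 := card_at_eq hC hI v
    have h2 := card_at_eq hC' hI' v'
    simp only [hev] at h1
    rw [hv'] at h2
    omega
  · have h1 : IsEmpty {e // (C.net hC).At p e} := ⟨fun ⟨e, he⟩ => hp ((C.net hC).at_mem he)⟩
    have h2 : IsEmpty {e // (C'.net hC').At p e} :=
      ⟨fun ⟨e, he⟩ => hp (hrange ▸ (C'.net hC').at_mem he)⟩
    rw [Nat.card_of_isEmpty, Nat.card_of_isEmpty]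

lemma hasEdge_of_adj (hC : C.IsSimple) {v w : C.V} (h : C.graph.Adj v w) :
    (C.net hC).HasEdge (C.pos v) (C.pos w) (Int.gcd (C.dir v w).1 (C.dir v w).2) :=
  ⟨Sum.inl ⟨s(v, w), h⟩, ⟨v, rfl, Sym2.mem_mk_left v w⟩, ⟨w, rfl, Sym2.mem_mk_right v w⟩, rfl⟩

lemma adj_of_hasEdge (hC : C.IsSimple) {v w : C.V} {a : ℕ} (hvw : v ≠ w)
    (h : (C.net hC).HasEdge (C.pos v) (C.pos w) a) :
    C.graph.Adj v w ∧ Int.gcd (C.dir v w).1 (C.dir v w).2 = a := by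
  obtain ⟨e, ⟨v', hv', h1⟩, ⟨w', hw', h2⟩, h3⟩ := h
  obtain rfl := hC.injective_vertices hv'
  obtain rfl := hC.injective_vertices hw'
  obtain ⟨h, rfl⟩ := eq_of_incident hvw h1 h2
  exact ⟨h, h3⟩

/-- The directions of the unmarked ends are determined by their rays. -/
lemma eq_of_smul_endDir {D D' : ℤ × ℤ} (h : D = (-1, 0) ∨ D = (0, -1) ∨ D = (1, 1))
    (h' : D' = (-1, 0) ∨ D' = (0, -1) ∨ D' = (1, 1)) {c : ℝ} (hc : 0 < c)
    (hD : toPlane D = c • toPlane D') : D = D' := by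
  have hg : ∀ D : ℤ × ℤ, (D = (-1, 0) ∨ D = (0, -1) ∨ D = (1, 1)) → Int.gcd D.1 D.2 = 1 := by
    rintro D (rfl | rfl | rfl) <;> rfl
  exact eq_of_parallel_of_gcd_eq ((hg D h).trans (hg D' h').symm) one_pos hc (by rwa [one_smul])

open Classical in
-- This expresses the unmarked ends with given vertex and derivative by the net alone: they are the
-- edges starting there with no second end.
lemma card_endFiber (hC : C.IsSimple) (p : ℝ × ℝ) {D : ℤ × ℤ}
    (hD : D = (-1, 0) ∨ D = (0, -1) ∨ D = (1, 1)) :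
    Nat.card {b // (C.pos (C.endAt b), C.endDir b) = (p, D)} =
      (((C.net hC).atCov p (toPlane D)).filter fun e => ¬ ∃ q, q ≠ p ∧ (C.net hC).At q e).card := by
  have hmem : ∀ e : (C.net hC).E, e ∈ ((C.net hC).atCov p (toPlane D)).filter
      (fun e => ¬ ∃ q, q ≠ p ∧ (C.net hC).At q e) ↔
      ((C.net hC).At p e ∧ (C.net hC).Covers e p (toPlane D)) ∧
        ¬ ∃ q, q ≠ p ∧ (C.net hC).At q e := by
    intro e
    rw [Finset.mem_filter, Net.mem_atCov]
  rw [← Nat.card_eq_finsetCard]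
  refine Nat.card_congr (Equiv.ofBijective (fun b => ⟨Sum.inr b.1, ?_⟩) ⟨?_, ?_⟩)
  · obtain ⟨b, hb⟩ := b
    simp only [Prod.mk.injEq] at hb
    obtain ⟨rfl, rfl⟩ := hb
    refine (hmem _).2 ⟨⟨⟨_, rfl, rfl⟩, covers_flagEdge hC (Sum.inr ⟨b, rfl⟩)⟩, ?_⟩
    rintro ⟨_, hq, v, rfl, h⟩
    exact hq (congrArg C.pos (Eq.symm h))
  · rintro ⟨b, hb⟩ ⟨b', hb'⟩ h
    exact Subtype.ext (Sum.inr.inj (congrArg Subtype.val h))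
  · rintro ⟨e, he⟩
    obtain ⟨⟨⟨v, rfl, h1⟩, h2⟩, h3⟩ := (hmem e).1 he
    obtain ⟨f, rfl⟩ := exists_flag h1
    have hD0 : toPlane D ≠ 0 := by
      rw [Ne, toPlane_eq_zero]
      rcases hD with rfl | rfl | rfl <;> simp
    have hat : (C.net hC).At (C.pos v) (flagEdge f) := ⟨v, rfl, incident_flagEdge f⟩
    obtain ⟨c, hc, hcc⟩ := (covers_flagEdge hC f).pos_parallel hat
      (fun h => flagDir_ne_zero hC f (toPlane_eq_zero.1 h)) hD0 h2
    rcases f with ⟨w, hw⟩ | ⟨b, rfl⟩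
    · exact absurd ⟨C.pos w, fun h => hw.ne (hC.injective_vertices h).symm, w, rfl,
        Sym2.mem_mk_right v w⟩ h3
    · exact ⟨⟨b, Prod.ext rfl (eq_of_smul_endDir hD (C.endDir_mem b) hc hcc).symm⟩, rfl⟩

lemma isEmpty_endFiber {p : ℝ × ℝ} {D : ℤ × ℤ}
    (h : p ∉ Set.range C.pos ∨ ¬ (D = (-1, 0) ∨ D = (0, -1) ∨ D = (1, 1))) :
    IsEmpty {b // (C.pos (C.endAt b), C.endDir b) = (p, D)} := by
  refine ⟨fun ⟨b, hb⟩ => ?_⟩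
  simp only [Prod.mk.injEq] at hb
  obtain ⟨rfl, rfl⟩ := hb
  exact h.elim (fun h => h ⟨_, rfl⟩) fun h => h (C.endDir_mem b)

/-- Two simple curves whose nets agree are the same curve. -/
lemma sameCurve_of_similar (hC : C.IsSimple) (hC' : C'.IsSimple)
    (h : Net.Similar (C.net hC) (C'.net hC')) (hev : ∀ i, C.ev i = C'.ev i) :
    C.SameCurve C' := by
  classical
  have hrange : Set.range C.pos = Set.range C'.pos := h.verts_eq
  let φ : C.V ≃ C'.V := (Equiv.ofInjective _ hC.injective_vertices).trans
    ((Equiv.setCongr hrange).trans (Equiv.ofInjective _ hC'.injective_vertices).symm)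
  have hφ : ∀ v, C'.pos (φ v) = C.pos v := fun v =>
    Equiv.apply_ofInjective_symm hC'.injective_vertices _
  have hadj : ∀ v w, C.graph.Adj v w → C'.graph.Adj (φ v) (φ w) ∧
      C'.dir (φ v) (φ w) = C.dir v w := by
    intro v w hvw
    have hne : C.pos v ≠ C.pos w := fun h => hvw.ne (hC.injective_vertices h)
    have h1 := (h.hasEdge_iff hne).1 (hasEdge_of_adj hC hvw)
    rw [← hφ v, ← hφ w] at h1
    obtain ⟨h2, h3⟩ := adj_of_hasEdge hC' (fun h => hvw.ne (φ.injective h)) h1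
    refine ⟨h2, eq_of_parallel_of_gcd_eq h3 (C'.len_pos _ _ h2) (C.len_pos _ _ hvw) ?_⟩
    have h4 := C.pos_eq v w hvw
    have h5 := C'.pos_eq _ _ h2
    rw [hφ, hφ, h4] at h5
    exact (add_left_cancel h5).symm
  have hadj' : ∀ v w, C'.graph.Adj (φ v) (φ w) → C.graph.Adj v w := by
    intro v w hvw
    have hne : C.pos v ≠ C.pos w := fun h => hvw.ne (congrArg φ (hC.injective_vertices h))
    have h1 := hasEdge_of_adj hC' hvw
    rw [hφ, hφ] at h1
    exact (adj_of_hasEdge hC (fun h => hne (congrArg _ h)) ((h.hasEdge_iff hne).2 h1)).1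
  have hcard : ∀ x : (ℝ × ℝ) × (ℤ × ℤ), Nonempty ({b // (C.pos (C.endAt b), C.endDir b) = x} ≃
      {b // (C'.pos (C'.endAt b), C'.endDir b) = x}) := by
    rintro ⟨p, D⟩
    by_cases hpD : p ∈ Set.range C.pos ∧ (D = (-1, 0) ∨ D = (0, -1) ∨ D = (1, 1))
    · obtain ⟨hp, hD⟩ := hpD
      have hD0 : toPlane D ≠ 0 := by
        rw [Ne, toPlane_eq_zero]
        rcases hD with rfl | rfl | rfl <;> simp
      rw [← Fintype.card_eq, ← Nat.card_eq_fintype_card, ← Nat.card_eq_fintype_card]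
      rw [card_endFiber hC p hD, card_endFiber hC' p hD]
      exact h.card_ends_eq hp hD0
    · rw [not_and_or] at hpD
      have := isEmpty_endFiber (C := C) hpD
      have := isEmpty_endFiber (C := C') (by rwa [← hrange])
      exact ⟨Equiv.equivOfIsEmpty _ _⟩
  -- The ends carry no labels, so any bijection that preserves attaching point and derivative will
  -- do; equal fibre sizes provide one.
  let ψ : C.End ≃ C'.End := Equiv.ofFiberEquiv fun x => (hcard x).some
  have hψ : ∀ b, (C'.pos (C'.endAt (ψ b)), C'.endDir (ψ b)) = (C.pos (C.endAt b), C.endDir b) :=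
    fun b => Equiv.ofFiberEquiv_map (f := fun b => (C.pos (C.endAt b), C.endDir b))
      (g := fun b => (C'.pos (C'.endAt b), C'.endDir b)) (fun x => (hcard x).some) b
  refine ⟨⟨⟨φ, fun {v w} => ⟨hadj' v w, fun h => (hadj v w h).1⟩⟩, ψ, ?_, ?_, ?_⟩, hφ,
    fun v w hvw => (hadj v w hvw).2, fun b => congrArg Prod.snd (hψ b)⟩
  · intro v w hvw
    obtain ⟨h2, h3⟩ := hadj v w hvw
    have h4 := C.pos_eq v w hvw
    have h5 := C'.pos_eq _ _ h2
    rw [hφ, hφ, h4, h3] at h5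
    exact (smul_left_injective ℝ (fun h => dir_ne_zero hC hvw (toPlane_eq_zero.1 h))
      (add_left_cancel h5)).symm
  · intro b
    refine hC'.injective_vertices ?_
    exact (congrArg Prod.fst (hψ b)).trans (hφ _).symm
  · intro i
    exact hC'.injective_vertices ((hev i).symm.trans (hφ _).symm)

end TropicalCurve
end TropicalDescendant

theorem mainTheorem4 (n d : ℕ) (r : Fin n → ℕ) (hdim : 3 * d = n + (∑ i, r i) + 1)
    (P : Fin n → ℝ × ℝ) (hP : TropicalDescendant.IsRestrictedGeneral d r P)
    (L : TropicalDescendant.LabelledImage)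
    (hL : ∃ C₀ : TropicalDescendant.TropicalCurve n d,
      TropicalDescendant.PassesThrough r P C₀ ∧ C₀.labelledImage = L) :
    ∃ C : TropicalDescendant.TropicalCurve n d, TropicalDescendant.Parametrizes r P L C ∧
      ∀ C' : TropicalDescendant.TropicalCurve n d, TropicalDescendant.Parametrizes r P L C' →
        TropicalDescendant.TropicalCurve.SameCurve C C' := by
  obtain ⟨C, hC, hCL⟩ := hL
  refine ⟨C, ⟨hC, hCL⟩, fun C' ⟨hC', hCL'⟩ => ?_⟩
  have hev : ∀ i, C.ev i = C'.ev i := fun i => (hC.2 i).trans (hC'.2 i).symm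
  obtain ⟨hI, hR⟩ := hP.1 C hC
  obtain ⟨hI', hR'⟩ := hP.1 C' hC'
  have hS := hP.2 C hC
  have hS' := hP.2 C' hC'
  exact TropicalDescendant.TropicalCurve.sameCurve_of_similar hS hS'
    (TropicalDescendant.TropicalCurve.net_similar hS hS' hI hI' hR hR' (hCL.trans hCL'.symm) hev) hev
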